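/- Let $G$ be a connected non-compact simple real Lie group with Lie algebra $\mathfrak g$, and let $K$ be a maximal compact subgroup of $G$ with Lie algebra $\mathfrak k$. Let $\mathfrak p$ be the orthogonal complement of $\mathfrak k$ in $\mathfrak g$ with respect to the Killing form, and assume that $\mathfrak g=\mathfrak p\oplus\mathfrak k$ is a Cartan decomposition (as is the case when the centre of $G$ is finite). The group $G\times K$ acts on $G$ by $(x,k)\,y=xyk^{-1}$, with isotropy subgroup $\Delta K=\{(k,k)\mid k\in K\}$ at the identity. Let $\mathcal M_K$ be the set of left-invariant Riemannian metrics on $G$ that are naturally reductive with respect to $G\times K$ and some reductive decomposition $\mathfrak g\oplus\mathfrak k=\mathfrak m\oplus\Delta\mathfrak k$; that is, $G\times K$ acts by isometries and, for the inner product on $\mathfrak m\cong T_eG$ corresponding to the metric, $\langle[u,v]_{\mathfrak m},w\rangle+\langle v,[u,w]_{\mathfrak m}\rangle=0$ for all $u,v,w\in\mathfrak m$. Let $S$ be the scalar curvature functional on $\mathcal M_K$. For a left-invariant symmetric $(0,2)$-tensor field $T$ on $G$, put $$\mathcal M_T^{+}=\{g\in\mathcal M_K\mid \operatorname{tr}_gT=1\},\quad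 \mathcal M_T^{-}=\{g\in\mathcal M_K\mid \operatorname{tr}_gT=-1\},\quad \mathcal M_T^{0}=\{g\in\mathcal M_K\mid \operatorname{tr}_gT=0\}.$$ A metric $g$ is called a critical point of the restriction of $S$ to one of these sets if it lies in the set and the derivative of $S$ at $g$ along every smooth curve in the set through $g$ is zero. It is a critical point up to scaling if $\tau g$ is a critical point for some constant $\tau>0$. Let $g\in\mathcal M_K$. Then: 1. The differential of $S$ at $g$ satisfies $dS_g(h)=-g(\operatorname{Ric}(g),h)$ for every $h$ tangent to $\mathcal M_K$ at $g$ (that is, for the velocity $h$ of every smooth curve in $\mathcal M_K$ through $g$), where $g(\cdot,\cdot)$ is the inner product on $(0,2)$-tensors induced by $g$. 2. Let $T$ be a left-invariant symmetric $(0,2)$-tensor field on $G$ that is invariant under the adjoint action of $K$. Then $\operatorname{Ric}(g)=cT$ for some $c\in\mathbb R$ if and only if, up to scaling, $g$ is a critical point of $S|_{\mathcal M_T^{+}}$, $S|_{\mathcal M_T^{-}}$ or $S|_{\mathcal M_T^{0}}$. 3. The "only if" direction of 2 holds for every left-invariant symmetric $(0,2)$-tensor field $T$ on $G$, without the invariance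 under $K$. -/

import Mathlib

open scoped Manifold ContDiff

noncomputable section

namespace LeftInv

/-! ### Left-invariant metrics and their curvature

A left-invariant (0,2)-tensor field on a Lie group `G` is identified with the bilinear form that
it induces on the Lie algebra `𝔤` of `G`. -/

section Curvature

variable {𝔤 : Type*} [LieRing 𝔤] [LieAlgebra ℝ 𝔤]

variable (𝔤) in
/-- A left-invariant Riemannian metric: an inner product on the Lie algebra. -/
structure Metric where
  form : LinearMap.BilinForm ℝ 𝔤
  symm : ∀ X Y, form X Y = form Y X
  pos : ∀ X, X ≠ 0 → 0 < form X X

namespace Metric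

theorem nondegenerate (g : Metric 𝔤) : g.form.Nondegenerate := by
  have key : ∀ X, (∀ Y, g.form X Y = 0) → X = 0 := fun X h => by
    by_contra hX
    exact (g.pos X hX).ne' (h X)
  exact ⟨key, fun X h => key X fun Y => by rw [g.symm]; exact h Y⟩

/-- The metric `τ g` for a positive constant `τ`. -/
def scale (g : Metric 𝔤) (τ : ℝ) (hτ : 0 < τ) : Metric 𝔤 where
  form := τ • g.form
  symm X Y := by simp [g.symm X Y]
  pos X hX := by simpa using mul_pos hτ (g.pos X hX)

variable [FiniteDimensional ℝ 𝔤]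

/-- The vector dual to a linear functional: `g (g.sharp f) Z = f Z`. -/
def sharp (g : Metric 𝔤) : Module.Dual ℝ 𝔤 ≃ₗ[ℝ] 𝔤 :=
  (g.form.toDual g.nondegenerate).symm

@[simp] theorem form_sharp (g : Metric 𝔤) (f : Module.Dual ℝ 𝔤) (Z : 𝔤) :
    g.form (g.sharp f) Z = f Z :=
  LinearMap.BilinForm.apply_toDual_symm_apply (hB := g.nondegenerate) f Z

/-- The endomorphism `A` with `g (A X) Y = T X Y`. -/
def raise (g : Metric 𝔤) (T : LinearMap.BilinForm ℝ 𝔤) : 𝔤 →ₗ[ℝ] 𝔤 :=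
  g.sharp.toLinearMap ∘ₗ T

/-- The trace `tr_g T` of a bilinear form with respect to `g`. -/
def tr (g : Metric 𝔤) (T : LinearMap.BilinForm ℝ 𝔤) : ℝ :=
  LinearMap.trace ℝ 𝔤 (g.raise T)

/-- The inner product `g (T, h)` induced by `g` on symmetric (0,2)-tensors. -/
def tensorInner (g : Metric 𝔤) (T h : LinearMap.BilinForm ℝ 𝔤) : ℝ :=
  LinearMap.trace ℝ 𝔤 (g.raise T ∘ₗ g.raise h)

/-- The functional `Z ↦ (g([X,Y],Z) - g([Y,Z],X) + g([Z,X],Y)) / 2` of the Koszul formula for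
left-invariant vector fields `X`, `Y`, `Z`. -/
def koszul (g : Metric 𝔤) : 𝔤 →ₗ[ℝ] 𝔤 →ₗ[ℝ] Module.Dual ℝ 𝔤 :=
  LinearMap.mk₂ ℝ
    (fun X Y => (1 / 2 : ℝ) • (g.form ⁅X, Y⁆ - g.form X ∘ₗ (LieAlgebra.ad ℝ 𝔤 Y : 𝔤 →ₗ[ℝ] 𝔤)
      - g.form Y ∘ₗ (LieAlgebra.ad ℝ 𝔤 X : 𝔤 →ₗ[ℝ] 𝔤)))
    (fun X X' Y => by ext Z; simp; ring)
    (fun c X Y => by ext Z; simp; ring)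
    (fun X Y Y' => by ext Z; simp; ring)
    (fun c X Y => by ext Z; simp; ring)

/-- The Levi-Civita connection `∇_X Y` of the left-invariant metric `g`, on left-invariant vector
fields. -/
def nabla (g : Metric 𝔤) : 𝔤 →ₗ[ℝ] 𝔤 →ₗ[ℝ] 𝔤 :=
  g.koszul.compr₂ g.sharp.toLinearMap

theorem koszul_formula (g : Metric 𝔤) (X Y Z : 𝔤) :
    2 * g.form (g.nabla X Y) Z
      = g.form ⁅X, Y⁆ Z - g.form ⁅Y, Z⁆ X + g.form ⁅Z, X⁆ Y := by
  rw [g.symm ⁅Y, Z⁆ X, g.symm ⁅Z, X⁆ Y, ← lie_skew Z X, map_neg]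
  simp only [nabla, koszul, LinearMap.compr₂_apply, LinearEquiv.coe_coe, form_sharp,
    LinearMap.mk₂_apply, LinearMap.smul_apply, LinearMap.sub_apply, LinearMap.comp_apply,
    LieAlgebra.ad_apply, smul_eq_mul]
  ring

theorem torsion_free (g : Metric 𝔤) (X Y : 𝔤) : g.nabla X Y - g.nabla Y X = ⁅X, Y⁆ := by
  refine sub_eq_zero.1 (g.nondegenerate.1 _ fun Z => ?_)
  have h1 := g.koszul_formula X Y Z
  have h2 := g.koszul_formula Y X Z
  rw [← lie_skew Y X, ← lie_skew X Z, ← lie_skew Z Y] at h2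
  simp only [map_sub, map_neg, LinearMap.sub_apply, LinearMap.neg_apply] at *
  linarith

/-- The functions `g (Y, Z)` are constant for left-invariant `Y`, `Z`, so this is the compatibility
of `∇` with `g`. -/
theorem metric_compatible (g : Metric 𝔤) (X Y Z : 𝔤) :
    g.form (g.nabla X Y) Z + g.form Y (g.nabla X Z) = 0 := by
  have h1 := g.koszul_formula X Y Z
  have h2 := g.koszul_formula X Z Y
  rw [← lie_skew Z Y, ← lie_skew Y X, ← lie_skew X Z] at h2
  rw [g.symm Y]
  simp only [map_neg, LinearMap.neg_apply] at *
  linarith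

/-- The curvature `R(X,Y) = ∇_X ∇_Y - ∇_Y ∇_X - ∇_[X,Y]`. -/
def curvature (g : Metric 𝔤) (X Y : 𝔤) : 𝔤 →ₗ[ℝ] 𝔤 :=
  g.nabla X ∘ₗ g.nabla Y - g.nabla Y ∘ₗ g.nabla X - g.nabla ⁅X, Y⁆

/-- The map `X ↦ R(X,Y)Z`. -/
def curvatureEnd (g : Metric 𝔤) (Y Z : 𝔤) : 𝔤 →ₗ[ℝ] 𝔤 where
  toFun X := g.curvature X Y Z
  map_add' X X' := by simp [curvature]; abel
  map_smul' c X := by simp [curvature, smul_sub]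

/-- The Ricci curvature `Ric(g)(Y,Z) = tr (X ↦ R(X,Y)Z)`. -/
def ric (g : Metric 𝔤) : LinearMap.BilinForm ℝ 𝔤 :=
  LinearMap.mk₂ ℝ (fun Y Z => LinearMap.trace ℝ 𝔤 (g.curvatureEnd Y Z))
    (fun Y Y' Z => by
      rw [← map_add]; congr 1; ext X; simp [curvatureEnd, curvature]; abel)
    (fun c Y Z => by
      rw [← map_smul]; congr 1; ext X; simp [curvatureEnd, curvature, smul_sub])
    (fun Y Z Z' => by
      rw [← map_add]; congr 1; ext X; simp [curvatureEnd, curvature]; abel)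
    (fun c Y Z => by
      rw [← map_smul]; congr 1; ext X; simp [curvatureEnd, curvature, smul_sub])

/-- The scalar curvature `S(g)`. -/
def scal (g : Metric 𝔤) : ℝ := g.tr g.ric

end Metric

/-! ### Naturally reductive metrics with respect to `G × K`

`G × K` acts on `G` by `(x, k) y = x y k⁻¹`. The isotropy subgroup at the identity is the diagonal
`ΔK`, and the differential of the orbit map at the identity is `(X, Z) ↦ X - Z`. A maximal compact
subgroup `K` of a connected `G` is connected, so invariance under `K` is the same as invariance
under its Lie algebra `𝔨`. -/

/-- Invariance of a bilinear form on `𝔤` under the adjoint action of `𝔨`. -/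
def IsInvariant (𝔨 : LieSubalgebra ℝ 𝔤) (T : LinearMap.BilinForm ℝ 𝔤) : Prop :=
  ∀ Z ∈ 𝔨, ∀ X Y : 𝔤, T ⁅Z, X⁆ Y + T X ⁅Z, Y⁆ = 0

/-- The diagonal `Δ𝔨` in `𝔤 ⊕ 𝔨`, the isotropy subalgebra. -/
def diagonal (𝔨 : LieSubalgebra ℝ 𝔤) : Submodule ℝ (𝔤 × 𝔨) :=
  LinearMap.range (LinearMap.prod (𝔨.toSubmodule.subtype) LinearMap.id)

/-- The bracket of the direct sum `𝔤 ⊕ 𝔨`. -/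
def sumBracket (𝔨 : LieSubalgebra ℝ 𝔤) (u v : 𝔤 × 𝔨) : 𝔤 × 𝔨 := (⁅u.1, v.1⁆, ⁅u.2, v.2⁆)

/-- The differential at the identity of the orbit map `G × K → G`. Its kernel is `Δ𝔨`, so it
identifies each complement of `Δ𝔨` with the tangent space of `G` at the identity. -/
def orbitMap (𝔨 : LieSubalgebra ℝ 𝔤) (u : 𝔤 × 𝔨) : 𝔤 := u.1 - (u.2 : 𝔤)

/-- `𝔤 ⊕ 𝔨 = 𝔪 ⊕ Δ𝔨` is a reductive decomposition. -/
structure IsReductiveComplement (𝔨 : LieSubalgebra ℝ 𝔤) (𝔪 : Submodule ℝ (𝔤 × 𝔨)) : Prop where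
  isCompl : IsCompl 𝔪 (diagonal 𝔨)
  stable : ∀ z ∈ diagonal 𝔨, ∀ u ∈ 𝔪, sumBracket 𝔨 z u ∈ 𝔪

/-- `g` is naturally reductive with respect to `G × K` and the decomposition given by `𝔪`:
`G × K` acts by isometries and `⟨[u,v]_𝔪, w⟩ + ⟨v, [u,w]_𝔪⟩ = 0` for `u, v, w ∈ 𝔪`, where `⟨ , ⟩` is
the inner product on `𝔪` that corresponds to `g`. The projection to `𝔪` along `Δ𝔨` may be omitted,
because `orbitMap` vanishes on `Δ𝔨`. -/
structure IsNaturallyReductive (𝔨 : LieSubalgebra ℝ 𝔤) (𝔪 : Submodule ℝ (𝔤 × 𝔨))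
    (g : Metric 𝔤) : Prop where
  reductive : IsReductiveComplement 𝔨 𝔪
  invariant : IsInvariant 𝔨 g.form
  skew : ∀ u ∈ 𝔪, ∀ v ∈ 𝔪, ∀ w ∈ 𝔪,
    g.form (orbitMap 𝔨 (sumBracket 𝔨 u v)) (orbitMap 𝔨 w)
      + g.form (orbitMap 𝔨 v) (orbitMap 𝔨 (sumBracket 𝔨 u w)) = 0

/-- The set `𝓜_K` of left-invariant metrics that are naturally reductive with respect to `G × K`
and some decomposition of the Lie algebra of `G × K`. -/
def natRed (𝔨 : LieSubalgebra ℝ 𝔤) : Set (Metric 𝔤) :=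
  {g | ∃ 𝔪 : Submodule ℝ (𝔤 × 𝔨), IsNaturallyReductive 𝔨 𝔪 g}

/-! ### Cartan decompositions -/

/-- The orthogonal complement `𝔭` of `𝔨` with respect to the Killing form. -/
def killingPerp (𝔨 : LieSubalgebra ℝ 𝔤) : Submodule ℝ 𝔤 where
  carrier := {X | ∀ Z ∈ 𝔨, killingForm ℝ 𝔤 X Z = 0}
  add_mem' hX hY Z hZ := by rw [map_add, LinearMap.add_apply, hX Z hZ, hY Z hZ, add_zero]
  zero_mem' Z _ := by simp
  smul_mem' c X hX Z hZ := by rw [map_smul, LinearMap.smul_apply, hX Z hZ, smul_zero]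

/-- `𝔤 = 𝔭 ⊕ 𝔨` is a Cartan decomposition, where `𝔭` is the orthogonal complement of `𝔨` with respect
to the Killing form. The inclusion `[𝔨,𝔭] ⊆ 𝔭` holds because the Killing form is invariant. -/
structure IsCartanDecomposition (𝔨 : LieSubalgebra ℝ 𝔤) : Prop where
  isCompl : IsCompl (killingPerp 𝔨) 𝔨.toSubmodule
  bracket_mem : ∀ X ∈ killingPerp 𝔨, ∀ Y ∈ killingPerp 𝔨, ⁅X, Y⁆ ∈ 𝔨
  neg : ∀ Z ∈ 𝔨, Z ≠ 0 → killingForm ℝ 𝔤 Z Z < 0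
  pos : ∀ X ∈ killingPerp 𝔨, X ≠ 0 → 0 < killingForm ℝ 𝔤 X X

/-! ### Critical points -/

/-- `γ` is a smooth curve `(-ε, ε) → M` with `γ 0 = g`. -/
structure IsCurveIn (M : Set (Metric 𝔤)) (g : Metric 𝔤) (ε : ℝ) (γ : ℝ → Metric 𝔤) : Prop where
  pos : 0 < ε
  smooth : ∀ X Y, ContDiffOn ℝ ∞ (fun t => (γ t).form X Y) (Set.Ioo (-ε) ε)
  mem : ∀ t ∈ Set.Ioo (-ε) ε, γ t ∈ M
  zero : γ 0 = g

/-- `h` is the velocity of the curve `γ` at time `0`. -/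
def HasVelocity (γ : ℝ → Metric 𝔤) (h : LinearMap.BilinForm ℝ 𝔤) : Prop :=
  ∀ X Y, HasDerivAt (fun t => (γ t).form X Y) (h X Y) 0

variable [FiniteDimensional ℝ 𝔤]

/-- The level set `{g ∈ 𝓜_K | tr_g T = σ}`; for `σ = 1, -1, 0` these are `𝓜_T⁺`, `𝓜_T⁻`, `𝓜_T⁰`. -/
def constraintSet (𝔨 : LieSubalgebra ℝ 𝔤) (T : LinearMap.BilinForm ℝ 𝔤) (σ : ℝ) :
    Set (Metric 𝔤) :=
  {g | g ∈ natRed 𝔨 ∧ g.tr T = σ}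

/-- `g` is a critical point of the scalar curvature restricted to `M`: the derivative of the scalar
curvature along every smooth curve in `M` through `g` vanishes. -/
def IsCriticalOn (M : Set (Metric 𝔤)) (g : Metric 𝔤) : Prop :=
  g ∈ M ∧ ∀ ε γ, IsCurveIn M g ε γ → HasDerivAt (fun t => (γ t).scal) 0 0

/-- Up to scaling, `g` is a critical point of the scalar curvature on `𝓜_T⁺`, `𝓜_T⁻` or `𝓜_T⁰`. -/
def IsCriticalUpToScaling (𝔨 : LieSubalgebra ℝ 𝔤) (T : LinearMap.BilinForm ℝ 𝔤)
    (g : Metric 𝔤) : Prop :=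
  ∃ (τ : ℝ) (hτ : 0 < τ), ∃ σ ∈ ({1, -1, 0} : Set ℝ),
    IsCriticalOn (constraintSet 𝔨 T σ) (g.scale τ hτ)

end Curvature

/-! ### Lie groups -/

section Group

variable {E : Type*} [NormedAddCommGroup E] [NormedSpace ℝ E]
  {G : Type*} [TopologicalSpace G] [ChartedSpace E G] [Group G]

/-- A smooth Lie group has the regularity under which Mathlib equips its tangent space at the
identity with the Lie bracket of left-invariant vector fields. -/
instance lieGroup_minSmoothness [LieGroup 𝓘(ℝ, E) ∞ G] :
    LieGroup 𝓘(ℝ, E) (minSmoothness ℝ 3) G :=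
  LieGroup.of_le (n := ∞) (by
    rw [minSmoothness_of_isRCLikeNormedField]
    exact WithTop.coe_le_coe.2 (le_top : (3 : ℕ∞) ≤ ⊤))

instance finiteDimensional_groupLieAlgebra [FiniteDimensional ℝ E] :
    FiniteDimensional ℝ (GroupLieAlgebra 𝓘(ℝ, E) G) :=
  inferInstanceAs (FiniteDimensional ℝ E)

/-- The Lie algebra of a closed subgroup `K` of `G`, as a set: the initial velocities of the
one-parameter subgroups of `G` that lie in `K`. -/
def subgroupLieAlgebra (K : Subgroup G) : Set (GroupLieAlgebra 𝓘(ℝ, E) G) :=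
  {X | ∃ γ : ℝ → G, ContMDiff 𝓘(ℝ, ℝ) 𝓘(ℝ, E) ∞ γ ∧ (∀ s t, γ (s + t) = γ s * γ t) ∧
    (∀ t, γ t ∈ K) ∧ mfderiv 𝓘(ℝ, ℝ) 𝓘(ℝ, E) γ 0 (1 : ℝ) = X}

/-- `K` is a maximal compact subgroup of `G`. -/
def IsMaximalCompact (K : Subgroup G) : Prop :=
  Maximal (fun K' : Subgroup G => IsCompact (K' : Set G)) K

end Group

end LeftInv

end

open LeftInv

namespace LeftInv

/-! ### Linear algebra -/

open Module

/-! A simple Lie algebra is unimodular, so left-invariant fields are divergence-free and `Ric(Y, Z)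
= -tr (∇Y ∘ ∇Z)`. Differentiate this along a curve of metrics, in a basis orthonormal at time `0`.
The derivatives of the Christoffel symbols are symmetric in the lower indices, the symbols
themselves are skew in the last two, and so the trace of the derivative of Ric vanishes. Only the
variation of the inverse metric remains, which gives `dS(h) = -g(Ric, h)` (`hasDerivAt_scal`). In
the same way `d(tr T)(h) = -g(T, h)` (`hasDerivAt_tr`). If `Ric = cT`, then `dS` is `c` times the
differential of the constraint, which is zero along constrained curves.

The converse needs enough curves inside `𝓜_K`. By `mem_natRed_of_isInvariant` every `𝔨`-invariant
metric lies in `𝓜_K`: irreducibility of `𝔭` determines the metric on `𝔭` up to a factor, and a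
nonzero mixed term between `𝔭` and `𝔨` yields an element of the centroid. Let `h = Ric - cT`, with
`c` chosen so that `g(T, h) = 0`; this form is symmetric and invariant. The curve from
`exists_curve` in direction `h` has an affine inverse metric, so `tr T` is exactly constant along it
and no regularity of the level set is needed. Criticality gives `g(Ric, h) = 0`, hence `g(h, h) = 0`
and `h = 0`. -/

theorem exists_basis_diagonal {V : Type*} [AddCommGroup V] [Module ℝ V] [FiniteDimensional ℝ V]
    (B h : LinearMap.BilinForm ℝ V) (hB : ∀ x y, B x y = B y x) (hpos : ∀ x, x ≠ 0 → 0 < B x x)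
    (hh : ∀ x y, h x y = h y x) :
    ∃ (n : ℕ) (e : Basis (Fin n) ℝ V) (l : Fin n → ℝ), n = finrank ℝ V ∧
      (∀ i j, B (e i) (e j) = if i = j then 1 else 0) ∧ ∀ i x, h (e i) x = l i * B (e i) x := by
  let core : InnerProductSpace.Core ℝ V :=
    { inner := fun x y => B x y
      conj_inner_symm := fun x y => by simp [hB x y]
      re_inner_nonneg := fun x => by
        by_cases hx : x = 0
        · simp [hx]
        · simpa using (hpos x hx).le
      add_left := fun x y z => by simp
      smul_left := fun x y r => by simp
      definite := fun x hx => by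
        by_contra h0
        exact (hpos x h0).ne' hx }
  let _ : NormedAddCommGroup V := core.toNormedAddCommGroup
  let _ : InnerProductSpace ℝ V := InnerProductSpace.ofCore core.toCore
  have hin : ∀ x y : V, inner ℝ x y = B x y := fun x y => rfl
  have key : ∀ X, (∀ Y, B X Y = 0) → X = 0 := fun X h => by
    by_contra hX
    exact (hpos X hX).ne' (h X)
  have hnd : B.Nondegenerate := ⟨key, fun X h => key X fun Y => by rw [hB]; exact h Y⟩
  let H : V →ₗ[ℝ] V := (B.toDual hnd).symm.toLinearMap ∘ₗ h
  have hH : ∀ x y, B (H x) y = h x y := fun x y =>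
    LinearMap.BilinForm.apply_toDual_symm_apply (hB := hnd) (h x) y
  have hsym : H.IsSymmetric := fun x y => by
    rw [hin, hin, hH, hB x, hH, hh]
  refine ⟨finrank ℝ V, (hsym.eigenvectorBasis rfl).toBasis, hsym.eigenvalues rfl, rfl, ?_, ?_⟩
  · intro i j
    rw [OrthonormalBasis.coe_toBasis, ← hin]
    exact orthonormal_iff_ite.1 (hsym.eigenvectorBasis rfl).orthonormal i j
  · intro i x
    rw [OrthonormalBasis.coe_toBasis, ← hH, hsym.apply_eigenvectorBasis]
    simp

theorem repr_eq_of_orthonormal {V : Type*} [AddCommGroup V] [Module ℝ V]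
    {ι : Type*} [Fintype ι] [DecidableEq ι] (B : LinearMap.BilinForm ℝ V) (e : Basis ι ℝ V)
    (he : ∀ i j, B (e i) (e j) = if i = j then 1 else 0) (x : V) (i : ι) :
    e.repr x i = B x (e i) := by
  conv_rhs => rw [← e.sum_repr x, map_sum, LinearMap.sum_apply]
  simp [he]

theorem trace_eq_sum_repr {V : Type*} [AddCommGroup V] [Module ℝ V]
    {ι : Type*} [Fintype ι] [DecidableEq ι] (e : Basis ι ℝ V) (L : V →ₗ[ℝ] V) :
    LinearMap.trace ℝ V L = ∑ i, e.repr (L (e i)) i := by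
  rw [LinearMap.trace_eq_matrix_trace ℝ e]
  simp [Matrix.trace, LinearMap.toMatrix_apply]

section

variable {𝔤 : Type*} [LieRing 𝔤] [LieAlgebra ℝ 𝔤]

namespace Metric

theorem ext_form {g : Metric 𝔤} {X Y : 𝔤} (h : ∀ Z, g.form X Z = g.form Y Z) : X = Y :=
  sub_eq_zero.1 (g.nondegenerate.1 _ fun Z => by simp [h Z])

theorem trace_eq_sum (g : Metric 𝔤) {ι : Type*} [Fintype ι] [DecidableEq ι] (e : Basis ι ℝ 𝔤)
    (he : ∀ i j, g.form (e i) (e j) = if i = j then 1 else 0) (L : 𝔤 →ₗ[ℝ] 𝔤) :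
    LinearMap.trace ℝ 𝔤 L = ∑ i, g.form (L (e i)) (e i) := by
  rw [trace_eq_sum_repr e]
  simp [repr_eq_of_orthonormal g.form e he]

end Metric

theorem scale_mem_natRed {𝔨 : LieSubalgebra ℝ 𝔤} {g : Metric 𝔤} (hg : g ∈ natRed 𝔨) (τ : ℝ)
    (hτ : 0 < τ) : g.scale τ hτ ∈ natRed 𝔨 := by
  obtain ⟨𝔪, h1, h2, h3⟩ := hg
  refine ⟨𝔪, h1, fun Z hZ X Y => ?_, fun u hu v hv w hw => ?_⟩
  · simp only [Metric.scale, LinearMap.smul_apply, smul_eq_mul, ← mul_add, h2 Z hZ X Y, mul_zero]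
  · simp only [Metric.scale, LinearMap.smul_apply, smul_eq_mul, ← mul_add, h3 u hu v hv w hw,
      mul_zero]

variable [FiniteDimensional ℝ 𝔤]

/-- The trace of a commutator vanishes, so the kernel of `X ↦ tr (ad X)` contains all brackets and
is an ideal. It is nonzero because a simple algebra is not abelian. -/
theorem trace_ad_eq_zero [LieAlgebra.IsSimple ℝ 𝔤] (X : 𝔤) :
    LinearMap.trace ℝ 𝔤 (LieAlgebra.ad ℝ 𝔤 X : 𝔤 →ₗ[ℝ] 𝔤) = 0 := by
  have hbr : ∀ X Y : 𝔤, LinearMap.trace ℝ 𝔤 (LieAlgebra.ad ℝ 𝔤 ⁅X, Y⁆ : 𝔤 →ₗ[ℝ] 𝔤) = 0 := by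
    intro X Y
    have : (LieAlgebra.ad ℝ 𝔤 ⁅X, Y⁆ : 𝔤 →ₗ[ℝ] 𝔤)
        = (LieAlgebra.ad ℝ 𝔤 X : 𝔤 →ₗ[ℝ] 𝔤) ∘ₗ (LieAlgebra.ad ℝ 𝔤 Y : 𝔤 →ₗ[ℝ] 𝔤)
          - (LieAlgebra.ad ℝ 𝔤 Y : 𝔤 →ₗ[ℝ] 𝔤) ∘ₗ (LieAlgebra.ad ℝ 𝔤 X : 𝔤 →ₗ[ℝ] 𝔤) := by
      ext Z
      simp
    rw [this, map_sub, LinearMap.trace_comp_comm', sub_self]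
  let I : LieIdeal ℝ 𝔤 :=
    { carrier := {X | LinearMap.trace ℝ 𝔤 (LieAlgebra.ad ℝ 𝔤 X : 𝔤 →ₗ[ℝ] 𝔤) = 0}
      add_mem' := fun {X Y} hX hY => by
        simp only [Set.mem_ofPred_eq] at *
        rw [map_add, map_add, hX, hY, add_zero]
      zero_mem' := by simp
      smul_mem' := fun c X hX => by
        simp only [Set.mem_ofPred_eq] at *
        rw [map_smul, map_smul, hX, smul_zero]
      lie_mem := fun {x m} _ => hbr x m }
  rcases LieAlgebra.IsSimple.eq_bot_or_eq_top (R := ℝ) I with h | h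
  · refine absurd ⟨fun x y => ?_⟩ (LieAlgebra.IsSimple.non_abelian ℝ (L := 𝔤))
    have : ⁅x, y⁆ ∈ I := hbr x y
    rwa [h, LieSubmodule.mem_bot] at this
  · exact (h ▸ LieSubmodule.mem_top X : X ∈ I)

/-! ### Ricci curvature on a unimodular Lie algebra and its invariance -/

namespace Metric

theorem form_raise (g : Metric 𝔤) (T : LinearMap.BilinForm ℝ 𝔤) (X Y : 𝔤) :
    g.form (g.raise T X) Y = T X Y := by
  simp [raise]

theorem exists_orthonormal_basis (g : Metric 𝔤) (h : LinearMap.BilinForm ℝ 𝔤)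
    (hh : ∀ X Y, h X Y = h Y X) :
    ∃ (n : ℕ) (e : Basis (Fin n) ℝ 𝔤) (l : Fin n → ℝ),
      (∀ i j, g.form (e i) (e j) = if i = j then 1 else 0) ∧
        ∀ i X, h (e i) X = l i * g.form (e i) X := by
  obtain ⟨n, e, l, -, h1, h2⟩ := exists_basis_diagonal g.form h g.symm g.pos hh
  exact ⟨n, e, l, h1, h2⟩

theorem tensorInner_eq_sum (g : Metric 𝔤) {ι : Type*} [Fintype ι] [DecidableEq ι] (e : Basis ι ℝ 𝔤)
    (he : ∀ i j, g.form (e i) (e j) = if i = j then 1 else 0) (T h : LinearMap.BilinForm ℝ 𝔤) :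
    g.tensorInner T h = ∑ i, ∑ j, h (e i) (e j) * T (e j) (e i) := by
  rw [tensorInner, trace_eq_sum g e he]
  refine Finset.sum_congr rfl fun i _ => ?_
  rw [LinearMap.comp_apply, form_raise]
  conv_lhs => rw [← e.sum_repr (g.raise h (e i))]
  simp [repr_eq_of_orthonormal g.form e he, form_raise]

theorem trace_eq_zero_of_skew (g : Metric 𝔤) (L : 𝔤 →ₗ[ℝ] 𝔤)
    (hL : ∀ X Y, g.form (L X) Y + g.form X (L Y) = 0) : LinearMap.trace ℝ 𝔤 L = 0 := by
  obtain ⟨n, e, -, he, -⟩ := g.exists_orthonormal_basis g.form g.symm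
  rw [trace_eq_sum g e he]
  refine Finset.sum_eq_zero fun i _ => ?_
  have h1 := hL (e i) (e i)
  rw [g.symm (e i)] at h1
  linarith

/-- The endomorphism `X ↦ ∇_X Y`. -/
noncomputable def covDeriv (g : Metric 𝔤) (Y : 𝔤) : 𝔤 →ₗ[ℝ] 𝔤 := g.nabla.flip Y

@[simp] theorem covDeriv_apply (g : Metric 𝔤) (X Y : 𝔤) : g.covDeriv Y X = g.nabla X Y := rfl

/-- On a unimodular group the Ricci curvature is `-tr (∇Y ∘ ∇Z)`. -/
theorem ric_eq_neg_trace (g : Metric 𝔤)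
    (huni : ∀ X : 𝔤, LinearMap.trace ℝ 𝔤 (LieAlgebra.ad ℝ 𝔤 X : 𝔤 →ₗ[ℝ] 𝔤) = 0) (Y Z : 𝔤) :
    g.ric Y Z = -LinearMap.trace ℝ 𝔤 (g.covDeriv Y ∘ₗ g.covDeriv Z) := by
  have hcov : ∀ V, g.covDeriv V = g.nabla V - (LieAlgebra.ad ℝ 𝔤 V : 𝔤 →ₗ[ℝ] 𝔤) := fun V => by
    ext X
    have := g.torsion_free V X
    simp [← this]
  -- The divergence of `V`: `∇_V` is skew for `g`, and `ad V` is traceless by unimodularity.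
  have hdiv : ∀ V, LinearMap.trace ℝ 𝔤 (g.covDeriv V) = 0 := fun V => by
    rw [hcov, map_sub, huni, sub_zero]
    exact g.trace_eq_zero_of_skew _ (g.metric_compatible V)
  have hend : g.curvatureEnd Y Z = g.covDeriv (g.nabla Y Z) - g.nabla Y ∘ₗ g.covDeriv Z
      + g.covDeriv Z ∘ₗ (LieAlgebra.ad ℝ 𝔤 Y : 𝔤 →ₗ[ℝ] 𝔤) := by
    ext X
    simp only [curvatureEnd, curvature, LinearMap.coe_mk, AddHom.coe_mk, LinearMap.sub_apply,
      LinearMap.comp_apply, LinearMap.add_apply, covDeriv_apply, LieAlgebra.ad_apply]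
    rw [← lie_skew Y X, map_neg, LinearMap.neg_apply, sub_eq_add_neg _ (g.nabla ⁅X, Y⁆ Z)]
  have h1 : g.ric Y Z = LinearMap.trace ℝ 𝔤 (g.curvatureEnd Y Z) := rfl
  rw [h1, hend, hcov Y, LinearMap.sub_comp, map_add, map_sub, hdiv, map_sub,
    LinearMap.trace_comp_comm']
  rw [LinearMap.trace_comp_comm' (g.covDeriv Z) (LieAlgebra.ad ℝ 𝔤 Y : 𝔤 →ₗ[ℝ] 𝔤)]
  rw [LinearMap.trace_comp_comm']
  ring

theorem ric_symm [LieAlgebra.IsSimple ℝ 𝔤] (g : Metric 𝔤) (Y Z : 𝔤) : g.ric Y Z = g.ric Z Y := by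
  rw [g.ric_eq_neg_trace trace_ad_eq_zero, g.ric_eq_neg_trace trace_ad_eq_zero,
    LinearMap.trace_comp_comm']

/-- The skew derivation `ad W` preserves both the bracket and the metric, the only ingredients of
the Koszul formula, so it also preserves the connection. -/
theorem lie_nabla (g : Metric 𝔤) (W : 𝔤)
    (hW : ∀ X Y : 𝔤, g.form ⁅W, X⁆ Y + g.form X ⁅W, Y⁆ = 0) (X Y : 𝔤) :
    ⁅W, g.nabla X Y⁆ = g.nabla ⁅W, X⁆ Y + g.nabla X ⁅W, Y⁆ := by
  refine g.ext_form fun Z => ?_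
  have k1 := g.koszul_formula X Y ⁅W, Z⁆
  have k2 := g.koszul_formula ⁅W, X⁆ Y Z
  have k3 := g.koszul_formula X ⁅W, Y⁆ Z
  have h0 := hW (g.nabla X Y) Z
  have h1 := hW ⁅X, Y⁆ Z
  have h2 := hW ⁅Y, Z⁆ X
  have h3 := hW ⁅Z, X⁆ Y
  rw [leibniz_lie] at h1 h2 h3
  simp only [map_add, LinearMap.add_apply] at *
  linarith

/-- By `lie_nabla`, `V ↦ ∇V` turns the action of `W` into the commutator with `ad W`, and a trace of
products is invariant under commutators. -/
theorem isInvariant_ric [LieAlgebra.IsSimple ℝ 𝔤] (g : Metric 𝔤) {𝔨 : LieSubalgebra ℝ 𝔤}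
    (hg : IsInvariant 𝔨 g.form) : IsInvariant 𝔨 g.ric := by
  intro W hW X Y
  have hcov : ∀ V, g.covDeriv ⁅W, V⁆ = (LieAlgebra.ad ℝ 𝔤 W : 𝔤 →ₗ[ℝ] 𝔤) ∘ₗ g.covDeriv V
      - g.covDeriv V ∘ₗ (LieAlgebra.ad ℝ 𝔤 W : 𝔤 →ₗ[ℝ] 𝔤) := fun V => by
    ext U
    simp [g.lie_nabla W (hg W hW)]
  rw [g.ric_eq_neg_trace trace_ad_eq_zero, g.ric_eq_neg_trace trace_ad_eq_zero, hcov, hcov,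
    LinearMap.sub_comp, LinearMap.comp_sub, map_sub, map_sub, LinearMap.comp_assoc,
    LinearMap.comp_assoc, LinearMap.trace_comp_comm', ← LinearMap.comp_assoc,
    ← LinearMap.comp_assoc]
  rw [LinearMap.comp_assoc, LinearMap.comp_assoc]
  ring

/-! ### Scaling -/

theorem sharp_scale (g : Metric 𝔤) (τ : ℝ) (hτ : 0 < τ) (f : Module.Dual ℝ 𝔤) :
    (g.scale τ hτ).sharp f = τ⁻¹ • g.sharp f := by
  refine (g.scale τ hτ).ext_form fun Z => ?_
  rw [form_sharp]
  simp [scale, hτ.ne']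

theorem nabla_scale (g : Metric 𝔤) (τ : ℝ) (hτ : 0 < τ) : (g.scale τ hτ).nabla = g.nabla := by
  ext X Y
  refine g.ext_form fun Z => ?_
  have h1 := (g.scale τ hτ).koszul_formula X Y Z
  have h2 := g.koszul_formula X Y Z
  simp only [scale, LinearMap.smul_apply, smul_eq_mul] at h1
  have h3 : τ * (2 * g.form ((g.scale τ hτ).nabla X Y) Z) = τ * (2 * g.form (g.nabla X Y) Z) := by
    rw [h2, ← sub_eq_zero]
    rw [← sub_eq_zero] at h1
    rw [← h1]
    simp only [scale]
    ring
  linarith [mul_left_cancel₀ hτ.ne' h3]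

theorem ric_scale (g : Metric 𝔤) (τ : ℝ) (hτ : 0 < τ) : (g.scale τ hτ).ric = g.ric := by
  ext X Y
  simp only [ric, LinearMap.mk₂_apply]
  congr 1
  ext Z
  simp only [curvatureEnd, curvature, nabla_scale]

theorem tr_scale (g : Metric 𝔤) (τ : ℝ) (hτ : 0 < τ) (T : LinearMap.BilinForm ℝ 𝔤) :
    (g.scale τ hτ).tr T = τ⁻¹ * g.tr T := by
  rw [tr, tr, ← smul_eq_mul, ← map_smul]
  congr 1
  ext X
  simp [raise, sharp_scale]

end Metric

end

/-! ### Variation of the scalar curvature -/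

open scoped Matrix.Norms.Operator in
-- The derivative of inversion at the identity is `-1`. The operator norm only serves to make
-- matrices a normed algebra.
theorem hasDerivAt_matrix_inv {ι : Type*} [Fintype ι] [DecidableEq ι]
    {M : ℝ → Matrix ι ι ℝ} {H : Matrix ι ι ℝ} (h0 : M 0 = 1)
    (hM : ∀ i j, HasDerivAt (fun t => M t i j) (H i j) 0) (i j : ι) :
    HasDerivAt (fun t => (M t)⁻¹ i j) (-H i j) 0 := by
  have h1 : HasDerivAt M H 0 := hasDerivAt_pi.2 fun i => hasDerivAt_pi.2 fun j => hM i j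
  have h2 := hasFDerivAt_ringInverse (𝕜 := ℝ) (1 : (Matrix ι ι ℝ)ˣ)
  rw [Units.val_one, ← h0] at h2
  have h3 := h2.comp_hasDerivAt (0 : ℝ) h1
  have h4 := hasDerivAt_pi.1 (hasDerivAt_pi.1 h3 i) j
  simpa [Function.comp_def, ← Matrix.nonsing_inv_eq_ringInverse, h0] using h4

/-- Exchanging `i` and `k` reverses the sign of the sum. It is applied with `C` the derivative of
the Christoffel symbols and `D` the symbols themselves. -/
theorem sum_symm_mul_skew_eq_zero {ι : Type*} [Fintype ι] (C D : ι → ι → ι → ℝ) (hC : ∀ k i l, C k i l = C i k l)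
    (hD : ∀ l i k, D l i k = -D l k i) : ∑ i, ∑ k, ∑ l, C k i l * D l i k = 0 := by
  have : ∑ i, ∑ k, ∑ l, C k i l * D l i k = -∑ i, ∑ k, ∑ l, C k i l * D l i k := by
    conv_lhs => rw [Finset.sum_comm]
    simp only [← Finset.sum_neg_distrib]
    refine Finset.sum_congr rfl fun i _ => Finset.sum_congr rfl fun k _ =>
      Finset.sum_congr rfl fun l _ => ?_
    rw [hC, hD]
    ring
  linarith

/-! ### Derivatives of Christoffel symbols, traces and scalar curvature along a curve -/

section

variable {𝔤 : Type*} [LieRing 𝔤] [LieAlgebra ℝ 𝔤] {ι : Type*} [Fintype ι] [DecidableEq ι]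

namespace Metric

/-- The Gram matrix of a basis. -/
noncomputable def gram (g : Metric 𝔤) (e : Basis ι ℝ 𝔤) : Matrix ι ι ℝ := Matrix.of fun i j => g.form (e i) (e j)

theorem isUnit_gram_det (g : Metric 𝔤) (e : Basis ι ℝ 𝔤) : IsUnit (g.gram e).det := by
  have : g.gram e = LinearMap.BilinForm.toMatrix e g.form := by
    ext i j
    simp [gram, LinearMap.BilinForm.toMatrix_apply]
  rw [this]
  exact isUnit_iff_ne_zero.2 ((LinearMap.BilinForm.nondegenerate_iff_det_ne_zero e).1
    g.nondegenerate)

variable [FiniteDimensional ℝ 𝔤]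

theorem repr_sharp (g : Metric 𝔤) (e : Basis ι ℝ 𝔤) (f : Module.Dual ℝ 𝔤) (l : ι) :
    e.repr (g.sharp f) l = ∑ m, f (e m) * (g.gram e)⁻¹ m l := by
  have h1 : (fun m => f (e m)) = Matrix.vecMul (fun l => e.repr (g.sharp f) l) (g.gram e) := by
    ext m
    rw [← g.form_sharp f]
    conv_lhs => rw [← e.sum_repr (g.sharp f), map_sum, LinearMap.sum_apply]
    simp [Matrix.vecMul, dotProduct, gram]
  have h2 := congrArg (fun v => Matrix.vecMul v (g.gram e)⁻¹ l) h1
  simp only [Matrix.vecMul_vecMul, Matrix.mul_nonsing_inv _ (g.isUnit_gram_det e),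
    Matrix.vecMul_one] at h2
  rw [← h2]
  rfl

theorem tr_eq_sum_gram (g : Metric 𝔤) (e : Basis ι ℝ 𝔤) (T : LinearMap.BilinForm ℝ 𝔤) :
    g.tr T = ∑ i, ∑ m, T (e i) (e m) * (g.gram e)⁻¹ m i := by
  rw [tr, trace_eq_sum_repr e]
  simp only [raise, LinearMap.comp_apply, LinearEquiv.coe_coe, repr_sharp]

/-- The Christoffel symbols of the Levi-Civita connection in a basis of left-invariant fields. -/
noncomputable def christoffel (g : Metric 𝔤) (e : Basis ι ℝ 𝔤) (k i l : ι) : ℝ :=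
  e.repr (g.nabla (e k) (e i)) l

/-- This separates the dependence on the metric into a factor linear in `g` and the inverse Gram
matrix, both of which can be differentiated. -/
theorem christoffel_eq_sum (g : Metric 𝔤) (e : Basis ι ℝ 𝔤) (k i l : ι) :
    g.christoffel e k i l = ∑ m, g.koszul (e k) (e i) (e m) * (g.gram e)⁻¹ m l := by
  rw [christoffel, nabla, LinearMap.compr₂_apply, LinearEquiv.coe_coe, repr_sharp]

theorem trace_covDeriv_comp (g : Metric 𝔤) (e : Basis ι ℝ 𝔤) (i m : ι) :
    LinearMap.trace ℝ 𝔤 (g.covDeriv (e i) ∘ₗ g.covDeriv (e m))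
      = ∑ k, ∑ l, g.christoffel e k m l * g.christoffel e l i k := by
  rw [trace_eq_sum_repr e]
  refine Finset.sum_congr rfl fun k _ => ?_
  rw [LinearMap.comp_apply, covDeriv_apply (Y := e m)]
  conv_lhs => rw [← e.sum_repr (g.nabla (e k) (e m)), map_sum, map_sum, Finset.sum_apply']
  simp [christoffel]

end Metric

variable {γ : ℝ → Metric 𝔤} {h : LinearMap.BilinForm ℝ 𝔤}
  {e : Basis ι ℝ 𝔤}

theorem hasDerivAt_gram_inv (hγ : HasVelocity γ h)
    (he : ∀ i j, (γ 0).form (e i) (e j) = if i = j then 1 else 0) (i j : ι) :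
    HasDerivAt (fun t => ((γ t).gram e)⁻¹ i j) (-h (e i) (e j)) 0 := by
  have h0 : (γ 0).gram e = 1 := by
    ext i j
    simp [Metric.gram, he, Matrix.one_apply]
  exact hasDerivAt_matrix_inv (H := Matrix.of fun i j => h (e i) (e j)) h0
    (fun i j => hγ (e i) (e j)) i j

theorem gram_inv_zero (he : ∀ i j, (γ 0).form (e i) (e j) = if i = j then 1 else 0) (i j : ι) :
    ((γ 0).gram e)⁻¹ i j = if i = j then 1 else 0 := by
  have h0 : (γ 0).gram e = 1 := by
    ext i j
    simp [Metric.gram, he, Matrix.one_apply]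
  rw [h0, inv_one, Matrix.one_apply]

variable [FiniteDimensional ℝ 𝔤]

/-- The value of the derivative is never needed, only its symmetry: by vanishing torsion, exchanging
the lower indices changes the symbol by a structure constant, which does not depend on `t`. -/
theorem exists_hasDerivAt_christoffel (hγ : HasVelocity γ h)
    (he : ∀ i j, (γ 0).form (e i) (e j) = if i = j then 1 else 0) :
    ∃ C : ι → ι → ι → ℝ,
      (∀ k i l, HasDerivAt (fun t => (γ t).christoffel e k i l) (C k i l) 0) ∧
        ∀ k i l, C k i l = C i k l := by
  have h1 : ∀ k i l, ∃ c, HasDerivAt (fun t => (γ t).christoffel e k i l) c 0 := by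
    intro k i l
    simp only [Metric.christoffel_eq_sum]
    have h2 : ∀ m, HasDerivAt (fun t => (γ t).koszul (e k) (e i) (e m))
        ((1 / 2 : ℝ) * (h ⁅e k, e i⁆ (e m) - h (e k) ⁅e i, e m⁆ - h (e i) ⁅e k, e m⁆)) 0 := by
      intro m
      simp only [Metric.koszul, LinearMap.mk₂_apply, LinearMap.smul_apply, LinearMap.sub_apply,
        LinearMap.comp_apply, LieAlgebra.ad_apply, smul_eq_mul]
      exact (((hγ _ _).fun_sub (hγ _ _)).fun_sub (hγ _ _)).const_mul _
    exact ⟨_, HasDerivAt.fun_sum fun m _ => (h2 m).fun_mul (hasDerivAt_gram_inv hγ he m l)⟩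
  choose C hC using h1
  refine ⟨C, hC, fun k i l => ?_⟩
  have h2 : (fun t => (γ t).christoffel e k i l)
      = fun t => (γ t).christoffel e i k l + e.repr ⁅e k, e i⁆ l := by
    ext t
    simp [Metric.christoffel, ← (γ t).torsion_free (e k) (e i)]
  have h3 := hC k i l
  rw [h2] at h3
  exact h3.unique ((hC i k l).add_const _)

/-- The derivative of `tr_g T` for fixed `T`. -/
theorem hasDerivAt_tr (hγ : HasVelocity γ h) (T : LinearMap.BilinForm ℝ 𝔤) :
    HasDerivAt (fun t => (γ t).tr T) (-(γ 0).tensorInner T h) 0 := by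
  obtain ⟨n, e, -, he, -⟩ := (γ 0).exists_orthonormal_basis (γ 0).form (γ 0).symm
  simp only [Metric.tr_eq_sum_gram _ e]
  refine (HasDerivAt.fun_sum fun i _ => HasDerivAt.fun_sum fun m _ =>
    (hasDerivAt_gram_inv hγ he m i).const_mul (T (e i) (e m))).congr_deriv ?_
  rw [Metric.tensorInner_eq_sum _ e he, Finset.sum_comm, ← Finset.sum_neg_distrib]
  refine Finset.sum_congr rfl fun i _ => ?_
  rw [← Finset.sum_neg_distrib]
  exact Finset.sum_congr rfl fun m _ => by ring

/-- The first variation of the scalar curvature of left-invariant metrics on a unimodular group. -/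
theorem hasDerivAt_scal (hγ : HasVelocity γ h)
    (huni : ∀ X : 𝔤, LinearMap.trace ℝ 𝔤 (LieAlgebra.ad ℝ 𝔤 X : 𝔤 →ₗ[ℝ] 𝔤) = 0) :
    HasDerivAt (fun t => (γ t).scal) (-(γ 0).tensorInner (γ 0).ric h) 0 := by
  obtain ⟨n, e, -, he, -⟩ := (γ 0).exists_orthonormal_basis (γ 0).form (γ 0).symm
  obtain ⟨C, hC, hsymm⟩ := exists_hasDerivAt_christoffel hγ he
  have hskew : ∀ l i k, (γ 0).christoffel e l i k = -(γ 0).christoffel e l k i := fun l i k => by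
    have h1 := (γ 0).metric_compatible (e l) (e i) (e k)
    rw [(γ 0).symm (e i)] at h1
    simp only [Metric.christoffel, repr_eq_of_orthonormal (γ 0).form e he]
    linarith
  have hric : ∀ i m, HasDerivAt (fun t => (γ t).ric (e i) (e m))
      (-∑ k, ∑ l, (C k m l * (γ 0).christoffel e l i k
        + (γ 0).christoffel e k m l * C l i k)) 0 := fun i m => by
    simp only [Metric.ric_eq_neg_trace _ huni, Metric.trace_covDeriv_comp _ e]
    exact (HasDerivAt.fun_sum fun k _ => HasDerivAt.fun_sum fun l _ =>
      (hC k m l).fun_mul (hC l i k)).fun_neg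
  simp only [Metric.scal, Metric.tr_eq_sum_gram _ e]
  refine (HasDerivAt.fun_sum fun i _ => HasDerivAt.fun_sum fun m _ =>
    (hric i m).fun_mul (hasDerivAt_gram_inv hγ he m i)).congr_deriv ?_
  -- The trace of the derivative of Ric. Both halves are the symmetric-against-skew sum, the second
  -- after renaming `k` and `l`.
  have hzero : ∑ i, ∑ k, ∑ l, (C k i l * (γ 0).christoffel e l i k
      + (γ 0).christoffel e k i l * C l i k) = 0 := by
    simp only [Finset.sum_add_distrib]
    have hz := sum_symm_mul_skew_eq_zero C _ hsymm hskew
    rw [hz, zero_add]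
    refine Eq.trans ?_ hz
    refine Finset.sum_congr rfl fun i _ => ?_
    rw [Finset.sum_comm]
    exact Finset.sum_congr rfl fun k _ => Finset.sum_congr rfl fun l _ => mul_comm _ _
  simp only [gram_inv_zero he, Finset.sum_add_distrib, mul_ite, mul_one, mul_zero,
    Finset.sum_ite_eq', Finset.mem_univ, if_true]
  simp only [Finset.sum_add_distrib] at hzero
  rw [Finset.sum_neg_distrib, Finset.sum_add_distrib, hzero, neg_zero, zero_add,
    Metric.tensorInner_eq_sum _ e he, Finset.sum_comm, ← Finset.sum_neg_distrib]
  refine Finset.sum_congr rfl fun i _ => ?_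
  rw [← Finset.sum_neg_distrib]
  exact Finset.sum_congr rfl fun m _ => by ring

end

/-! ### Invariant metrics are naturally reductive -/

section

variable {𝔤 : Type*} [LieRing 𝔤] [LieAlgebra ℝ 𝔤] {𝔨 : LieSubalgebra ℝ 𝔤}

theorem killingForm_symm (X Y : 𝔤) : killingForm ℝ 𝔤 X Y = killingForm ℝ 𝔤 Y X :=
  LieModule.traceForm_comm ℝ 𝔤 𝔤 X Y

theorem killingForm_lie (X Y Z : 𝔤) : killingForm ℝ 𝔤 ⁅X, Y⁆ Z = killingForm ℝ 𝔤 X ⁅Y, Z⁆ :=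
  LieModule.traceForm_apply_lie_apply ℝ 𝔤 𝔤 X Y Z

theorem killingForm_lie_add (X Y Z : 𝔤) :
    killingForm ℝ 𝔤 ⁅X, Y⁆ Z + killingForm ℝ 𝔤 Y ⁅X, Z⁆ = 0 := by
  rw [← lie_skew, map_neg, LinearMap.neg_apply, killingForm_lie, neg_add_cancel]

theorem lie_mem_killingPerp {Z X : 𝔤} (hZ : Z ∈ 𝔨) (hX : X ∈ killingPerp 𝔨) :
    ⁅Z, X⁆ ∈ killingPerp 𝔨 := fun W hW => by
  rw [← lie_skew, map_neg, LinearMap.neg_apply, killingForm_lie, hX _ (𝔨.lie_mem hZ hW), neg_zero]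

theorem lie_mem_killingPerp_right {X Z : 𝔤} (hX : X ∈ killingPerp 𝔨) (hZ : Z ∈ 𝔨) :
    ⁅X, Z⁆ ∈ killingPerp 𝔨 := by
  rw [← lie_skew]
  exact (killingPerp 𝔨).neg_mem (lie_mem_killingPerp hZ hX)

/-! ### Consequences of the Cartan decomposition and irreducibility of `𝔭` -/

namespace IsCartanDecomposition

theorem exists_add (hC : IsCartanDecomposition 𝔨) (X : 𝔤) :
    ∃ x ∈ killingPerp 𝔨, ∃ z ∈ 𝔨, X = x + z := by
  have h : X ∈ killingPerp 𝔨 ⊔ 𝔨.toSubmodule := hC.isCompl.sup_eq_top ▸ Submodule.mem_top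
  obtain ⟨x, hx, z, hz, rfl⟩ := Submodule.mem_sup.1 h
  exact ⟨x, hx, z, hz, rfl⟩

theorem eq_zero_of_killingPerp (hC : IsCartanDecomposition 𝔨) {X : 𝔤} (hX : X ∈ killingPerp 𝔨)
    (h : killingForm ℝ 𝔤 X X = 0) : X = 0 := by
  by_contra h0
  exact (hC.pos X hX h0).ne' h

theorem eq_zero_of_mem (hC : IsCartanDecomposition 𝔨) {Z : 𝔤} (hZ : Z ∈ 𝔨)
    (h : killingForm ℝ 𝔤 Z Z = 0) : Z = 0 := by
  by_contra h0
  exact (hC.neg Z hZ h0).ne h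

theorem nondegenerate (hC : IsCartanDecomposition 𝔨) : (killingForm ℝ 𝔤).Nondegenerate := by
  have key : ∀ X, (∀ Y, killingForm ℝ 𝔤 X Y = 0) → X = 0 := fun X h =>
    hC.eq_zero_of_killingPerp (fun Z _ => h Z) (h X)
  exact ⟨key, fun X h => key X fun Y => by rw [killingForm_symm]; exact h Y⟩

theorem mem_of_forall_killingPerp (hC : IsCartanDecomposition 𝔨) {X : 𝔤}
    (h : ∀ x ∈ killingPerp 𝔨, killingForm ℝ 𝔤 X x = 0) : X ∈ 𝔨 := by
  obtain ⟨x, hx, z, hz, rfl⟩ := hC.exists_add X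
  have h1 := h x hx
  rw [map_add, LinearMap.add_apply, killingForm_symm z, hx z hz, add_zero] at h1
  rwa [hC.eq_zero_of_killingPerp hx h1, zero_add]

variable [FiniteDimensional ℝ 𝔤] [LieAlgebra.IsSimple ℝ 𝔤]

/-- The isotropy representation on `𝔭` is irreducible. -/
theorem eq_killingPerp_of_stable (hC : IsCartanDecomposition 𝔨) (W : Submodule ℝ 𝔤)
    (hW : W ≤ killingPerp 𝔨) (hst : ∀ z ∈ 𝔨, ∀ x ∈ W, ⁅z, x⁆ ∈ W) (hne : ∃ x ∈ W, x ≠ 0) :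
    W = killingPerp 𝔨 := by
  refine le_antisymm hW fun y hy => ?_
  have hrefl : (killingForm ℝ 𝔤).IsRefl := fun X Y h => by rw [killingForm_symm, h]
  have hdisj : Disjoint W (LinearMap.BilinForm.orthogonal (killingForm ℝ 𝔤) W) :=
    Submodule.disjoint_def.2 fun x hx hx' => hC.eq_zero_of_killingPerp (hW hx) (hx' x hx)
  have hcompl := (LinearMap.BilinForm.isCompl_orthogonal_iff_disjoint hrefl).2 hdisj
  have hdec : ∀ v ∈ killingPerp 𝔨, ∃ w ∈ W, ∃ u ∈ killingPerp 𝔨,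
      (∀ x ∈ W, killingForm ℝ 𝔤 x u = 0) ∧ v = w + u := by
    intro v hv
    have h : v ∈ W ⊔ LinearMap.BilinForm.orthogonal (killingForm ℝ 𝔤) W :=
      hcompl.sup_eq_top ▸ Submodule.mem_top
    obtain ⟨w, hw, u, hu, rfl⟩ := Submodule.mem_sup.1 h
    exact ⟨w, hw, u, ((killingPerp 𝔨).add_mem_iff_right (hW hw)).1 hv, hu, rfl⟩
  have hst' : ∀ z ∈ 𝔨, ∀ u ∈ killingPerp 𝔨, (∀ x ∈ W, killingForm ℝ 𝔤 x u = 0) →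
      ∀ x ∈ W, killingForm ℝ 𝔤 x ⁅z, u⁆ = 0 := by
    intro z hz u _ hu' x hx
    rw [← killingForm_lie, ← lie_skew, map_neg, LinearMap.neg_apply, hu' _ (hst z hz x hx),
      neg_zero]
  -- For `u` in `𝔭` orthogonal to `W`, `[x, u]` lies in `𝔨`, where the Killing form `B` is definite.
  -- Moreover `B([x, u], [x, u]) = -B(x, [[x, u], u])`, which vanishes since `𝔨` preserves the
  -- complement of `W`.
  have hcomm : ∀ x ∈ W, ∀ u ∈ killingPerp 𝔨, (∀ x ∈ W, killingForm ℝ 𝔤 x u = 0) → ⁅x, u⁆ = 0 := by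
    intro x hx u hu hu'
    have hmem := hC.bracket_mem x (hW hx) u hu
    refine hC.eq_zero_of_mem hmem ?_
    rw [killingForm_lie, ← lie_skew, map_neg, hst' _ hmem u hu hu' x hx, neg_zero]
  -- The centralizer of the complement of `W` in `𝔭` is an ideal containing `W`, so it is all of
  -- `𝔤`. The complement is then central, and the Killing form vanishes on it.
  let I : LieIdeal ℝ 𝔤 :=
    { carrier := {X | ∀ u ∈ killingPerp 𝔨, (∀ x ∈ W, killingForm ℝ 𝔤 x u = 0) → ⁅X, u⁆ = 0}
      add_mem' := fun {X Y} hX hY u hu hu' => by rw [add_lie, hX u hu hu', hY u hu hu', add_zero]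
      zero_mem' := fun u _ _ => zero_lie u
      smul_mem' := fun c X hX u hu hu' => by rw [smul_lie, hX u hu hu', smul_zero]
      lie_mem := fun {V X} hX u hu hu' => by
        obtain ⟨v, hv, z, hz, rfl⟩ := hC.exists_add V
        obtain ⟨w, hw, v', hv', hvo, rfl⟩ := hdec v hv
        have hX' : ∀ u ∈ killingPerp 𝔨, (∀ x ∈ W, killingForm ℝ 𝔤 x u = 0) → ⁅X, u⁆ = 0 := hX
        have h1 : ⁅v', X⁆ = 0 := by rw [← lie_skew, hX' v' hv' hvo, neg_zero]
        rw [add_lie, add_lie, add_lie, h1, add_zero, lie_lie, lie_lie z, hX' u hu hu',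
          hcomm w hw u hu hu', hX' _ (lie_mem_killingPerp hz hu) (hst' z hz u hu hu')]
        simp }
  obtain ⟨x0, hx0, hx0'⟩ := hne
  rcases LieAlgebra.IsSimple.eq_bot_or_eq_top (R := ℝ) I with h | h
  · have : x0 ∈ I := fun u hu hu' => hcomm x0 hx0 u hu hu'
    rw [h, LieSubmodule.mem_bot] at this
    exact absurd this hx0'
  · obtain ⟨w, hw, u, hu, hu', rfl⟩ := hdec y hy
    have h0 : u = 0 := by
      refine hC.eq_zero_of_killingPerp hu ?_
      have had : (LieAlgebra.ad ℝ 𝔤 u : 𝔤 →ₗ[ℝ] 𝔤) = 0 := by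
        ext X
        have h1 : X ∈ I := h ▸ LieSubmodule.mem_top X
        have h2 : ⁅X, u⁆ = 0 := h1 u hu hu'
        rw [LieAlgebra.ad_apply, ← lie_skew, h2, neg_zero, LinearMap.zero_apply]
      rw [killingForm_apply_apply, had]
      simp
    rwa [h0, add_zero]

/-- An invariant symmetric form is proportional to the Killing form on `𝔭`. -/
theorem exists_eq_mul_killingForm (hC : IsCartanDecomposition 𝔨) (h : LinearMap.BilinForm ℝ 𝔤)
    (hsymm : ∀ X Y, h X Y = h Y X) (hinv : IsInvariant 𝔨 h) :
    ∃ c : ℝ, ∀ x ∈ killingPerp 𝔨, ∀ y ∈ killingPerp 𝔨, h x y = c * killingForm ℝ 𝔤 x y := by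
  obtain ⟨n, e, l, hn, he, hl⟩ := exists_basis_diagonal (V := killingPerp 𝔨)
    ((killingForm ℝ 𝔤).restrict (killingPerp 𝔨)) (h.restrict (killingPerp 𝔨))
    (fun x y => killingForm_symm (x : 𝔤) y)
    (fun x hx => hC.pos x x.2 fun h0 => hx (Subtype.ext h0)) (fun x y => hsymm x y)
  rcases Nat.eq_zero_or_pos n with h0 | h0
  · rw [h0, eq_comm, Submodule.finrank_eq_zero] at hn
    refine ⟨0, fun x hx y _ => ?_⟩
    rw [hn, Submodule.mem_bot] at hx
    simp [hx]
  let i : Fin n := ⟨0, h0⟩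
  -- The eigenspace of `h` relative to the Killing form on `𝔭`: it is nonzero and `𝔨`-stable, so
  -- irreducibility applies.
  let W : Submodule ℝ 𝔤 :=
    { carrier := {x | x ∈ killingPerp 𝔨 ∧ ∀ y ∈ killingPerp 𝔨, h x y = l i * killingForm ℝ 𝔤 x y}
      add_mem' := fun {a b} ha hb => ⟨Submodule.add_mem _ ha.1 hb.1, fun y hy => by
        rw [map_add, map_add, LinearMap.add_apply, LinearMap.add_apply, ha.2 y hy, hb.2 y hy,
          mul_add]⟩
      zero_mem' := ⟨Submodule.zero_mem _, fun y _ => by simp⟩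
      smul_mem' := fun c a ha => ⟨Submodule.smul_mem _ c ha.1, fun y hy => by
        rw [map_smul, map_smul, LinearMap.smul_apply, LinearMap.smul_apply, ha.2 y hy, smul_eq_mul,
          smul_eq_mul, mul_left_comm]⟩ }
  have hW : W = killingPerp 𝔨 := by
    refine hC.eq_killingPerp_of_stable W (fun x hx => hx.1) (fun z hz x hx => ?_)
      ⟨e i, ⟨(e i).2, fun y hy => hl i ⟨y, hy⟩⟩, ?_⟩
    · refine ⟨lie_mem_killingPerp hz hx.1, fun y hy => ?_⟩
      have h1 := hinv z hz x y
      have h2 := killingForm_lie_add z x y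
      rw [hx.2 _ (lie_mem_killingPerp hz hy)] at h1
      linear_combination h1 - l i * h2
    · intro h1
      exact e.ne_zero i (Subtype.ext h1)
  exact ⟨l i, fun x hx y hy => (hW ▸ hx : x ∈ W).2 y hy⟩

end IsCartanDecomposition

variable [FiniteDimensional ℝ 𝔤]

/-- A metric is naturally reductive if on `𝔭` it comes from an invariant form on `𝔤`, which is
described by an element of the centroid. -/
theorem mem_natRed_of_centroid (hC : IsCartanDecomposition 𝔨) (g : Metric 𝔤)
    (hinv : IsInvariant 𝔨 g.form) (M : 𝔤 →ₗ[ℝ] 𝔤) (hlie : ∀ X Y : 𝔤, M ⁅X, Y⁆ = ⁅X, M Y⁆)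
    (hsymm : ∀ X Y, killingForm ℝ 𝔤 (M X) Y = killingForm ℝ 𝔤 X (M Y))
    (hM : ∀ x ∈ killingPerp 𝔨, ∀ X, g.form (M x) X = killingForm ℝ 𝔤 x X) : g ∈ natRed 𝔨 := by
  let G : 𝔤 →ₗ[ℝ] 𝔤 :=
    ((killingForm ℝ 𝔤).toDual hC.nondegenerate).symm.toLinearMap ∘ₗ g.form
  have hG : ∀ X Y, killingForm ℝ 𝔤 (G X) Y = g.form X Y := fun X Y =>
    LinearMap.BilinForm.apply_toDual_symm_apply (hB := hC.nondegenerate) (g.form X) Y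
  have hGlie : ∀ z ∈ 𝔨, ∀ X, G ⁅z, X⁆ = ⁅z, G X⁆ := fun z hz X => by
    refine sub_eq_zero.1 (hC.nondegenerate.1 _ fun Y => ?_)
    have h1 := killingForm_lie_add z (G X) Y
    have h2 := hinv z hz X Y
    rw [hG] at h1
    rw [map_sub, LinearMap.sub_apply, hG]
    linarith
  have hmem : ∀ X, M (G X) - X ∈ 𝔨 := fun X => by
    refine hC.mem_of_forall_killingPerp fun x hx => ?_
    rw [map_sub, LinearMap.sub_apply, hsymm, hG, g.symm, hM x hx, killingForm_symm, sub_self]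
  let φ : 𝔤 →ₗ[ℝ] 𝔨 :=
    { toFun := fun X => ⟨M (G X) - X, hmem X⟩
      map_add' := fun X Y => Subtype.ext (by
        change M (G (X + Y)) - (X + Y) = (M (G X) - X) + (M (G Y) - Y)
        rw [map_add, map_add]
        abel)
      map_smul' := fun c X => Subtype.ext (by simp [smul_sub]) }
  have hφ : ∀ X, (φ X : 𝔤) = M (G X) - X := fun X => rfl
  -- The complement `𝔪` is the image of this section of `orbitMap`; its second component is in `𝔨`
  -- by `hmem`.
  let s : 𝔤 →ₗ[ℝ] 𝔤 × 𝔨 := LinearMap.prod (M ∘ₗ G) φ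
  have hs : ∀ X, s X = (M (G X), φ X) := fun X => rfl
  have horb : ∀ X, orbitMap 𝔨 (s X) = X := fun X => by
    simp [orbitMap, hs, hφ]
  have hdiag : ∀ u : 𝔤 × 𝔨, u ∈ diagonal 𝔨 ↔ u.1 = u.2 := fun u => by
    constructor
    · rintro ⟨z, rfl⟩
      rfl
    · intro h
      exact ⟨u.2, Prod.ext h.symm rfl⟩
  refine ⟨LinearMap.range s, ⟨⟨?_, ?_⟩, ?_⟩, hinv, ?_⟩
  · rw [Submodule.disjoint_def]
    rintro _ ⟨X, rfl⟩ h
    have h1 := horb X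
    rw [orbitMap, (hdiag _).1 h, sub_self] at h1
    rw [← h1, map_zero]
  · rw [codisjoint_iff, Submodule.eq_top_iff']
    intro u
    refine Submodule.mem_sup.2 ⟨s (u.1 - u.2), ⟨_, rfl⟩, u - s (u.1 - u.2), ?_, by abel⟩
    rw [hdiag]
    change u.1 - M (G (u.1 - u.2)) = u.2 - (M (G (u.1 - u.2)) - (u.1 - u.2))
    abel
  · rintro z hz _ ⟨X, rfl⟩
    obtain ⟨z, rfl⟩ := hz
    refine ⟨⁅(z : 𝔤), X⁆, ?_⟩
    have h1 : M (G ⁅(z : 𝔤), X⁆) = ⁅(z : 𝔤), M (G X)⁆ := by rw [hGlie z z.2, hlie]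
    refine Prod.ext ?_ (Subtype.ext ?_)
    · exact h1
    · change M (G ⁅(z : 𝔤), X⁆) - ⁅(z : 𝔤), X⁆ = ⁅(z : 𝔤), M (G X) - X⁆
      rw [h1, lie_sub]
  · rintro _ ⟨X, rfl⟩ _ ⟨Y, rfl⟩ _ ⟨Z, rfl⟩
    have key : ∀ Y, orbitMap 𝔨 (sumBracket 𝔨 (s X) (s Y)) = ⁅X, M (G Y)⁆ + ⁅(φ X : 𝔤), Y⁆ := by
      intro Y
      have h1 : M (G X) = X + φ X := by simp [hφ]
      have h2 : orbitMap 𝔨 (sumBracket 𝔨 (s X) (s Y))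
        = ⁅M (G X), M (G Y)⁆ - ⁅(φ X : 𝔤), (φ Y : 𝔤)⁆ := rfl
      rw [h2, h1, hφ Y, add_lie, lie_sub]
      abel
    rw [key, key, horb, horb]
    -- The `φ X` part is skew because `g` is `𝔨`-invariant. For the `X` part, moving `M` across the
    -- Killing form reduces the claim to invariance of that form.
    have h1 := hinv (φ X) (φ X).2 Y Z
    have h2 : g.form ⁅X, M (G Y)⁆ Z = killingForm ℝ 𝔤 ⁅X, G Y⁆ (M (G Z)) := by
      rw [g.symm, ← hG, killingForm_symm, ← hlie, hsymm]
    have h3 : g.form Y ⁅X, M (G Z)⁆ = killingForm ℝ 𝔤 (G Y) ⁅X, M (G Z)⁆ := (hG _ _).symm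
    have h4 := killingForm_lie_add X (G Y) (M (G Z))
    rw [map_add, LinearMap.add_apply, map_add, h2, h3]
    linarith

/-- `𝓜_K` consists of all invariant metrics. If `𝔭` and `𝔨` are isomorphic as representations of
`𝔨`, then the metric need not be diagonal and `𝔤` is complex. -/
theorem mem_natRed_of_isInvariant [LieAlgebra.IsSimple ℝ 𝔤] (hC : IsCartanDecomposition 𝔨)
    (g : Metric 𝔤) (hinv : IsInvariant 𝔨 g.form) : g ∈ natRed 𝔨 := by
  obtain ⟨b, hb⟩ := hC.exists_eq_mul_killingForm g.form g.symm hinv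
  let π : 𝔤 →ₗ[ℝ] 𝔤 := (killingPerp 𝔨).projection 𝔨.toSubmodule hC.isCompl
  have hπp : ∀ x ∈ killingPerp 𝔨, π x = x := fun x hx =>
    Submodule.projection_apply_left hC.isCompl ⟨x, hx⟩
  have hπk : ∀ z ∈ 𝔨, π z = 0 := fun z hz =>
    (Submodule.projection_apply_eq_zero_iff hC.isCompl).2 hz
  have hπlie : ∀ z ∈ 𝔨, ∀ X, π ⁅z, X⁆ = ⁅z, π X⁆ := fun z hz X => by
    obtain ⟨x, hx, w, hw, rfl⟩ := hC.exists_add X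
    rw [lie_add, map_add, map_add, hπp _ (lie_mem_killingPerp hz hx), hπk _ (𝔨.lie_mem hz hw),
      hπp x hx, hπk w hw, add_zero, add_zero]
  -- The mixed part of `g`, pairing `𝔭` with `𝔨`. Its Killing operator `D` is symmetric,
  -- `𝔨`-equivariant and exchanges `𝔭` and `𝔨`.
  let d : LinearMap.BilinForm ℝ 𝔤 :=
    g.form.compl₁₂ π (LinearMap.id - π) + g.form.compl₁₂ (LinearMap.id - π) π
  have hd : ∀ X Y, d X Y = g.form (π X) (Y - π Y) + g.form (X - π X) (π Y) := fun X Y => rfl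
  let D : 𝔤 →ₗ[ℝ] 𝔤 := ((killingForm ℝ 𝔤).toDual hC.nondegenerate).symm.toLinearMap ∘ₗ d
  have hD : ∀ X Y, killingForm ℝ 𝔤 (D X) Y = d X Y := fun X Y =>
    LinearMap.BilinForm.apply_toDual_symm_apply (hB := hC.nondegenerate) (d X) Y
  have hDsymm : ∀ X Y, killingForm ℝ 𝔤 (D X) Y = killingForm ℝ 𝔤 X (D Y) := fun X Y => by
    rw [hD, killingForm_symm, hD, hd, hd, g.symm (π X), g.symm (X - π X), add_comm]
  have hDlie : ∀ z ∈ 𝔨, ∀ X, D ⁅z, X⁆ = ⁅z, D X⁆ := fun z hz X => by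
    refine sub_eq_zero.1 (hC.nondegenerate.1 _ fun Y => ?_)
    have h1 := killingForm_lie_add z (D X) Y
    have h2 := hinv z hz (π X) (Y - π Y)
    have h3 := hinv z hz (X - π X) (π Y)
    rw [hD, hd, hπlie z hz, ← lie_sub] at h1
    rw [map_sub, LinearMap.sub_apply, hD, hd, hπlie z hz, ← lie_sub]
    linarith
  have hDp : ∀ x ∈ killingPerp 𝔨, D x ∈ 𝔨 := fun x hx =>
    hC.mem_of_forall_killingPerp fun y hy => by simp [hD, hd, hπp x hx, hπp y hy]
  have hDk : ∀ z ∈ 𝔨, D z ∈ killingPerp 𝔨 := fun z hz w hw => by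
    simp [hD, hd, hπk z hz, hπk w hw]
  have hDg : ∀ x ∈ killingPerp 𝔨, ∀ z ∈ 𝔨, g.form x z = killingForm ℝ 𝔤 (D x) z :=
    fun x hx z hz => by simp [hD, hd, hπk z hz, hπp x hx]
  -- Without a mixed part `g` is block diagonal, and a multiple of the identity serves as `M`.
  by_cases hD0 : ∀ x ∈ killingPerp 𝔨, D x = 0
  · refine mem_natRed_of_centroid hC g hinv (b⁻¹ • LinearMap.id) (fun X Y => by simp)
      (fun X Y => by simp) fun x hx X => ?_
    by_cases hx0 : x = 0
    · simp [hx0]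
    have hb0 : b ≠ 0 := by
      rintro rfl
      have := hb x hx x hx
      rw [zero_mul] at this
      exact (g.pos x hx0).ne' this
    obtain ⟨y, hy, z, hz, rfl⟩ := hC.exists_add X
    simp only [LinearMap.smul_apply, LinearMap.id_apply, map_smul, map_add, smul_eq_mul,
      hb x hx y hy, hDg x hx z hz, hD0 x hx, hx z hz, map_zero, LinearMap.zero_apply, add_zero]
    field_simp
    ring
  push Not at hD0
  obtain ⟨x0, hx0, hDx0⟩ := hD0
  have hx0' : x0 ≠ 0 := by
    rintro rfl
    exact hDx0 (map_zero D)
  have hcomp : ∀ f : LinearMap.BilinForm ℝ 𝔤, IsInvariant 𝔨 f → IsInvariant 𝔨 (f.compl₁₂ D D) :=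
    fun f hf z hz X Y => by
      simp only [LinearMap.compl₁₂_apply, hDlie z hz]
      exact hf z hz _ _
  -- Irreducibility of `𝔭` makes both pulled-back forms multiples of the Killing form. The aim is to
  -- show that `D` lies in the centroid with `D² = ν`; as `ν` is negative, this makes `𝔤` complex.
  obtain ⟨ν, hν⟩ := hC.exists_eq_mul_killingForm ((killingForm ℝ 𝔤).compl₁₂ D D)
    (fun X Y => killingForm_symm _ _) (hcomp _ fun z _ X Y => killingForm_lie_add z X Y)
  obtain ⟨μ, hμ⟩ := hC.exists_eq_mul_killingForm (g.form.compl₁₂ D D)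
    (fun X Y => g.symm _ _) (hcomp _ hinv)
  simp only [LinearMap.compl₁₂_apply] at hν hμ
  have hν0 : ν ≠ 0 := by
    rintro rfl
    have h1 := hν x0 hx0 x0 hx0
    rw [zero_mul] at h1
    exact hDx0 (hC.eq_zero_of_mem (hDp x0 hx0) h1)
  have hμ0 : μ ≠ 0 := by
    rintro rfl
    have h1 := hμ x0 hx0 x0 hx0
    rw [zero_mul] at h1
    exact (g.pos _ hDx0).ne' h1
  have hext : ∀ x ∈ killingPerp 𝔨, ∀ y ∈ killingPerp 𝔨,
      (∀ w ∈ killingPerp 𝔨, killingForm ℝ 𝔤 x w = killingForm ℝ 𝔤 y w) → x = y :=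
    fun x hx y hy h => by
      have hm := Submodule.sub_mem _ hx hy
      refine sub_eq_zero.1 (hC.eq_zero_of_killingPerp hm ?_)
      rw [LinearMap.map_sub₂, h _ hm, sub_self]
  have hDDp : ∀ x ∈ killingPerp 𝔨, D (D x) = ν • x := fun x hx =>
    hext _ (hDk _ (hDp x hx)) _ (Submodule.smul_mem _ _ hx) fun w hw => by
      rw [hDsymm, hν x hx w hw, map_smul, LinearMap.smul_apply, smul_eq_mul]
  have hinj : ∀ x ∈ killingPerp 𝔨, ∀ y ∈ killingPerp 𝔨, D x = D y → x = y := fun x hx y hy h => by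
    have h1 := congrArg D h
    rw [hDDp x hx, hDDp y hy] at h1
    exact smul_right_injective 𝔤 hν0 h1
  -- The kernel of the action of `𝔨` on `𝔭` is an ideal inside `𝔨`, and `x0` is outside it.
  have hcent : ∀ z ∈ 𝔨, (∀ x ∈ killingPerp 𝔨, ⁅z, x⁆ = 0) → z = 0 := by
    let I : LieIdeal ℝ 𝔤 :=
      { carrier := {z | z ∈ 𝔨 ∧ ∀ x ∈ killingPerp 𝔨, ⁅z, x⁆ = 0}
        add_mem' := fun {z w} hz hw => ⟨𝔨.add_mem hz.1 hw.1, fun x hx => by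
          rw [add_lie, hz.2 x hx, hw.2 x hx, add_zero]⟩
        zero_mem' := ⟨𝔨.zero_mem, fun x _ => zero_lie x⟩
        smul_mem' := fun c z hz => ⟨𝔨.smul_mem c hz.1, fun x hx => by
          rw [smul_lie, hz.2 x hx, smul_zero]⟩
        lie_mem := fun {V z} hz => by
          obtain ⟨hz1, hz2⟩ : z ∈ 𝔨 ∧ ∀ x ∈ killingPerp 𝔨, ⁅z, x⁆ = 0 := hz
          obtain ⟨v, hv, w, hw, rfl⟩ := hC.exists_add V
          rw [add_lie, ← lie_skew v, hz2 v hv, neg_zero, zero_add]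
          refine ⟨𝔨.lie_mem hw hz1, fun x hx => ?_⟩
          rw [lie_lie, hz2 x hx, hz2 _ (lie_mem_killingPerp hw hx), lie_zero, sub_zero] }
    intro z hz hz'
    rcases LieAlgebra.IsSimple.eq_bot_or_eq_top (R := ℝ) I with h | h
    · have : z ∈ I := ⟨hz, hz'⟩
      rwa [h, LieSubmodule.mem_bot] at this
    · have h1 : x0 ∈ I := h ▸ LieSubmodule.mem_top x0
      exact absurd (hC.eq_zero_of_killingPerp hx0 (hx0 x0 h1.1)) hx0'
  have hkerk : ∀ z ∈ 𝔨, D z = 0 → z = 0 := fun z hz hDz => by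
    refine hcent z hz fun x hx => hinj _ (lie_mem_killingPerp hz hx) 0 (Submodule.zero_mem _) ?_
    rw [map_zero, hDlie z hz]
    refine hC.eq_zero_of_mem (𝔨.lie_mem hz (hDp x hx)) ?_
    set w := ⁅z, D x⁆ with hw
    have hwk : w ∈ 𝔨 := 𝔨.lie_mem hz (hDp x hx)
    -- `B(w, w) = -B(z, D [w, x]) = -B(D z, [w, x]) = 0`.
    rw [hw, killingForm_lie, ← hw, ← lie_skew, ← hDlie w hwk, map_neg, ← hDsymm, hDz]
    simp
  have hDDk : ∀ z ∈ 𝔨, D (D z) = ν • z := fun z hz => by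
    refine sub_eq_zero.1 (hkerk _ (𝔨.sub_mem (hDp _ (hDk z hz)) (𝔨.smul_mem ν hz)) ?_)
    rw [map_sub, hDDp _ (hDk z hz), map_smul, sub_self]
  have hsurj : ∀ z ∈ 𝔨, ∃ y ∈ killingPerp 𝔨, z = D y := fun z hz => by
    refine ⟨ν⁻¹ • D z, Submodule.smul_mem _ _ (hDk z hz), ?_⟩
    rw [map_smul, hDDk z hz, inv_smul_smul₀ hν0]
  -- Applying `D`, which is injective on `𝔭`, turns both sides into `[D y, D w]`.
  have hlie1 : ∀ y ∈ killingPerp 𝔨, ∀ w ∈ killingPerp 𝔨, ⁅D y, w⁆ = ⁅y, D w⁆ :=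
    fun y hy w hw => by
      have h1 : ⁅y, D w⁆ = -⁅D w, y⁆ := (lie_skew _ _).symm
      refine hinj _ (lie_mem_killingPerp (hDp y hy) hw) _ ?_ ?_
      · exact lie_mem_killingPerp_right hy (hDp w hw)
      · rw [hDlie _ (hDp y hy), h1, map_neg, hDlie _ (hDp w hw), lie_skew]
  have hlie2 : ∀ x ∈ killingPerp 𝔨, ∀ y ∈ killingPerp 𝔨, D ⁅x, y⁆ = ⁅x, D y⁆ :=
    fun x hx y hy => by
      refine hext _ (hDk _ (hC.bracket_mem x hx y hy)) _
        (lie_mem_killingPerp_right hx (hDp y hy)) fun w hw => ?_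
      rw [hDsymm, killingForm_lie, killingForm_lie, hlie1 y hy w hw]
  have hcentroid : ∀ X Y, D ⁅X, Y⁆ = ⁅X, D Y⁆ := fun X Y => by
    obtain ⟨x, hx, z, hz, rfl⟩ := hC.exists_add X
    obtain ⟨y, hy, w, hw, rfl⟩ := hC.exists_add Y
    obtain ⟨v, hv, rfl⟩ := hsurj w hw
    have h1 : D ⁅x, D v⁆ = ⁅x, D (D v)⁆ := by
      rw [← hlie2 x hx v hv, hDDk _ (hC.bracket_mem x hx v hv), hDDp v hv, lie_smul]
    rw [add_lie, map_add, hDlie z hz, add_lie, lie_add, map_add, hlie2 x hx y hy, h1, ← lie_add,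
      ← map_add]
  have hgDk : ∀ x ∈ killingPerp 𝔨, ∀ z ∈ 𝔨,
      g.form (D x) z = μ / ν * killingForm ℝ 𝔤 (D x) z := fun x hx z hz => by
    obtain ⟨y, hy, rfl⟩ := hsurj z hz
    rw [hμ x hx y hy, hν x hx y hy]
    field_simp
  have hDgp : ∀ x ∈ killingPerp 𝔨, ∀ y ∈ killingPerp 𝔨,
      g.form (D x) y = ν * killingForm ℝ 𝔤 x y := fun x hx y hy => by
    rw [g.symm, hDg y hy _ (hDp x hx), hν y hy x hx, killingForm_symm]
  -- On `x0 - (ν/μ) D x0` the value of `g` is `(b - ν²/μ) B(x0, x0)`, and this vector is nonzero.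
  have hb0 : b - ν ^ 2 / μ ≠ 0 := by
    intro h0
    have hne : x0 - (ν / μ) • D x0 ≠ 0 := fun h => by
      have h1 : x0 ∈ 𝔨 := by
        rw [sub_eq_zero.1 h]
        exact 𝔨.smul_mem _ (hDp x0 hx0)
      exact hx0' (hC.eq_zero_of_killingPerp hx0 (hx0 x0 h1))
    refine (g.pos _ hne).ne' ?_
    have h1 := hDgp x0 hx0 x0 hx0
    have h2 := g.symm x0 (D x0)
    simp only [map_sub, map_smul, LinearMap.sub_apply, LinearMap.smul_apply, smul_eq_mul, h2, h1,
      hb x0 hx0 x0 hx0, hμ x0 hx0 x0 hx0]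
    have h3 : b = ν ^ 2 / μ := sub_eq_zero.1 h0
    rw [h3]
    field_simp
    ring
  set m := (b - ν ^ 2 / μ)⁻¹ with hm
  have hm1 : m * (b - ν ^ 2 / μ) = 1 := inv_mul_cancel₀ hb0
  -- For `x` in `𝔭`, the vector `x - (ν/μ) D x` is `g`-orthogonal to `𝔨` and pairs with `𝔭` as `(b -
  -- ν²/μ) B(x, ·)`; the factor `m` normalizes this.
  refine mem_natRed_of_centroid hC g hinv (m • LinearMap.id - (m * ν / μ) • D)
    (fun X Y => by simp [hcentroid]) (fun X Y => by simp [hDsymm]) fun x hx X => ?_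
  obtain ⟨y, hy, z, hz, rfl⟩ := hC.exists_add X
  simp only [LinearMap.sub_apply, LinearMap.smul_apply, LinearMap.id_apply, map_sub, map_smul,
    map_add, smul_eq_mul, hb x hx y hy, hDg x hx z hz, hDgp x hx y hy, hgDk x hx z hz, hx z hz]
  have h1 : m * ν / μ * (μ / ν * killingForm ℝ 𝔤 (D x) z) = m * killingForm ℝ 𝔤 (D x) z := by
    field_simp
  linear_combination killingForm ℝ 𝔤 x y * hm1 - h1

end

/-! ### Critical points -/

section

variable {𝔤 : Type*} [LieRing 𝔤] [LieAlgebra ℝ 𝔤] {𝔨 : LieSubalgebra ℝ 𝔤}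

namespace Metric

theorem eq_of_form_eq {g g' : Metric 𝔤} (h : ∀ X Y, g.form X Y = g'.form X Y) : g = g' := by
  have h1 : g.form = g'.form := LinearMap.ext₂ h
  cases g
  cases g'
  simpa using h1

/-- The metric that is diagonal in a given basis, with given positive entries. -/
noncomputable def ofBasis {ι : Type*} [Fintype ι] (e : Basis ι ℝ 𝔤) (c : ι → ℝ)
    (hc : ∀ i, 0 < c i) : Metric 𝔤 where
  form := ∑ i, c i • LinearMap.BilinForm.linMulLin (e.coord i) (e.coord i)
  symm X Y := by simp [LinearMap.sum_apply, mul_comm]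
  pos X hX := by
    simp only [LinearMap.sum_apply, LinearMap.smul_apply, LinearMap.BilinForm.linMulLin_apply,
      smul_eq_mul, Basis.coord_apply]
    have hne : e.repr X ≠ 0 := fun h => hX (by simpa using h)
    obtain ⟨i, hi⟩ := Finsupp.ne_iff.1 hne
    exact Finset.sum_pos' (fun j _ => mul_nonneg (hc j).le (mul_self_nonneg _))
      ⟨i, Finset.mem_univ i, mul_pos (hc i) (mul_self_pos.2 hi)⟩

theorem ofBasis_form {ι : Type*} [Fintype ι] (e : Basis ι ℝ 𝔤) (c : ι → ℝ) (hc : ∀ i, 0 < c i)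
    (X Y : 𝔤) : (ofBasis e c hc).form X Y = ∑ i, c i * (e.repr X i * e.repr Y i) := by
  simp [ofBasis, LinearMap.sum_apply]

end Metric

theorem IsCurveIn.exists_hasVelocity {M : Set (Metric 𝔤)} {g : Metric 𝔤} {ε : ℝ}
    {γ : ℝ → Metric 𝔤} (hc : IsCurveIn M g ε γ) : ∃ h, HasVelocity γ h := by
  have hd : ∀ X Y, HasDerivAt (fun t => (γ t).form X Y) (deriv (fun t => (γ t).form X Y) 0) 0 :=
    fun X Y => (((hc.smooth X Y).contDiffAt (Ioo_mem_nhds (neg_lt_zero.2 hc.pos)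
      hc.pos)).differentiableAt (by simp)).hasDerivAt
  refine ⟨LinearMap.mk₂ ℝ (fun X Y => deriv (fun t => (γ t).form X Y) 0) (fun X X' Y => ?_)
    (fun c X Y => ?_) (fun X Y Y' => ?_) (fun c X Y => ?_), hd⟩
  · simpa using ((hd X Y).fun_add (hd X' Y)).deriv
  · simp
  · simpa using ((hd X Y).fun_add (hd X Y')).deriv
  · simp

variable [FiniteDimensional ℝ 𝔤]

namespace Metric

theorem raise_sub (g : Metric 𝔤) (T S : LinearMap.BilinForm ℝ 𝔤) :
    g.raise (T - S) = g.raise T - g.raise S := LinearMap.comp_sub _ _ _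

theorem raise_smul (g : Metric 𝔤) (c : ℝ) (T : LinearMap.BilinForm ℝ 𝔤) :
    g.raise (c • T) = c • g.raise T := LinearMap.comp_smul _ _ _

theorem tensorInner_comm (g : Metric 𝔤) (T S : LinearMap.BilinForm ℝ 𝔤) :
    g.tensorInner T S = g.tensorInner S T := LinearMap.trace_comp_comm' _ _

theorem tensorInner_sub_left (g : Metric 𝔤) (T T' S : LinearMap.BilinForm ℝ 𝔤) :
    g.tensorInner (T - T') S = g.tensorInner T S - g.tensorInner T' S := by
  simp only [tensorInner, raise_sub, LinearMap.sub_comp, map_sub]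

theorem tensorInner_smul_left (g : Metric 𝔤) (c : ℝ) (T S : LinearMap.BilinForm ℝ 𝔤) :
    g.tensorInner (c • T) S = c * g.tensorInner T S := by
  simp only [tensorInner, raise_smul, LinearMap.smul_comp, map_smul, smul_eq_mul]

theorem eq_zero_of_tensorInner_self (g : Metric 𝔤) {h : LinearMap.BilinForm ℝ 𝔤}
    (hh : ∀ X Y, h X Y = h Y X) (h0 : g.tensorInner h h = 0) : h = 0 := by
  obtain ⟨n, e, -, he, -⟩ := g.exists_orthonormal_basis g.form g.symm
  rw [tensorInner_eq_sum g e he] at h0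
  have h1 : ∑ i, ∑ j, h (e i) (e j) * h (e i) (e j) = 0 := by
    rw [← h0]
    exact Finset.sum_congr rfl fun i _ => Finset.sum_congr rfl fun j _ => by rw [hh (e j) (e i)]
  rw [Finset.sum_eq_zero_iff_of_nonneg fun i _ =>
    Finset.sum_nonneg fun j _ => mul_self_nonneg _] at h1
  refine LinearMap.BilinForm.ext_basis e fun i j => ?_
  have h2 := h1 i (Finset.mem_univ i)
  rw [Finset.sum_eq_zero_iff_of_nonneg fun j _ => mul_self_nonneg _] at h2
  simpa using h2 j (Finset.mem_univ j)

end Metric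

/-- Every invariant symmetric form is the velocity of a curve of invariant metrics whose inverses
depend on the parameter in an affine way. -/
theorem exists_curve (g : Metric 𝔤) (hg : IsInvariant 𝔨 g.form) (h : LinearMap.BilinForm ℝ 𝔤)
    (hsymm : ∀ X Y, h X Y = h Y X) (hinv : IsInvariant 𝔨 h) :
    ∃ ε γ, IsCurveIn {g' | IsInvariant 𝔨 g'.form} g ε γ ∧ HasVelocity γ h ∧
      ∀ t ∈ Set.Ioo (-ε) ε, ∀ T, (γ t).tr T = g.tr T - t * g.tensorInner T h := by
  obtain ⟨n, e, l, he, hl⟩ := g.exists_orthonormal_basis h hsymm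
  -- The value `1` only keeps the metric defined for large `t`; it plays no role on the interval
  -- used below.
  have hpos : ∀ t i, 0 < if 0 < 1 - t * l i then (1 - t * l i)⁻¹ else 1 := fun t i => by
    split_ifs with h1
    · exact inv_pos.2 h1
    · exact one_pos
  let γ : ℝ → Metric 𝔤 := fun t => Metric.ofBasis e _ (hpos t)
  set b : ℝ := 1 + ∑ i, |l i| with hb
  have hb0 : 0 < b := add_pos_of_pos_of_nonneg one_pos (Finset.sum_nonneg fun i _ => abs_nonneg _)
  have hlt : ∀ t ∈ Set.Ioo (-b⁻¹) b⁻¹, ∀ i, 0 < 1 - t * l i := fun t ht i => by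
    have h1 : |l i| ≤ ∑ j, |l j| :=
      Finset.single_le_sum (fun j _ => abs_nonneg (l j)) (Finset.mem_univ i)
    have h2 : |t| < b⁻¹ := abs_lt.2 ht
    have h3 : |t * l i| < 1 := by
      rw [abs_mul]
      calc |t| * |l i| ≤ |t| * b := by gcongr; linarith
        _ < b⁻¹ * b := by gcongr
        _ = 1 := inv_mul_cancel₀ hb0.ne'
    linarith [le_abs_self (t * l i)]
  have hform : ∀ t ∈ Set.Ioo (-b⁻¹) b⁻¹, ∀ X Y,
      (γ t).form X Y = ∑ i, (1 - t * l i)⁻¹ * (e.repr X i * e.repr Y i) := fun t ht X Y => by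
    rw [Metric.ofBasis_form]
    exact Finset.sum_congr rfl fun i _ => by rw [if_pos (hlt t ht i)]
  have hmem0 : (0 : ℝ) ∈ Set.Ioo (-b⁻¹) b⁻¹ := ⟨neg_lt_zero.2 (inv_pos.2 hb0), inv_pos.2 hb0⟩
  have hAe : ∀ i, g.raise h (e i) = l i • e i := fun i => g.ext_form fun Z => by
    rw [Metric.form_raise, hl, map_smul, LinearMap.smul_apply, smul_eq_mul]
  -- With `A = g.raise h`, this says that the inverse of `γ t` is `(1 - tA) g⁻¹`. Invariance and the
  -- trace formula both follow from it.
  have hkey : ∀ t ∈ Set.Ioo (-b⁻¹) b⁻¹, ∀ X Y,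
      (γ t).form (X - t • g.raise h X) Y = g.form X Y := by
    intro t ht X Y
    have h1 : (γ t).form ∘ₗ (LinearMap.id - t • g.raise h) = g.form := by
      refine e.ext fun i => LinearMap.ext fun Y => ?_
      have h2 : e i - t • l i • e i = (1 - t * l i) • e i := by
        rw [sub_smul, one_smul, mul_smul]
      rw [LinearMap.comp_apply, LinearMap.sub_apply, LinearMap.id_apply, LinearMap.smul_apply,
        hAe, h2, map_smul, LinearMap.smul_apply, hform t ht, g.symm,
        ← repr_eq_of_orthonormal g.form e he]
      have h3 := (hlt t ht i).ne'
      simp [Finsupp.single_apply, h3]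
    exact LinearMap.congr_fun (LinearMap.congr_fun h1 X) Y
  have hsurj : ∀ t ∈ Set.Ioo (-b⁻¹) b⁻¹,
      Function.Surjective (LinearMap.id - t • g.raise h : 𝔤 →ₗ[ℝ] 𝔤) := by
    intro t ht
    refine LinearMap.injective_iff_surjective.1 ((injective_iff_map_eq_zero _).2 fun X hX => ?_)
    have h1 := hkey t ht X X
    have h2 : X - t • g.raise h X = 0 := hX
    rw [h2, map_zero, LinearMap.zero_apply] at h1
    by_contra hX0
    exact (g.pos X hX0).ne h1
  have hAlie : ∀ Z ∈ 𝔨, ∀ X, g.raise h ⁅Z, X⁆ = ⁅Z, g.raise h X⁆ := fun Z hZ X =>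
    g.ext_form fun Y => by
      have h1 := hinv Z hZ X Y
      have h2 := hg Z hZ (g.raise h X) Y
      rw [Metric.form_raise] at h2 ⊢
      linarith
  refine ⟨b⁻¹, γ, ⟨hmem0.2, fun X Y => ?_, fun t ht Z hZ X Y => ?_, ?_⟩, fun X Y => ?_,
    fun t ht T => ?_⟩
  · refine ContDiffOn.congr ?_ fun t ht => hform t ht X Y
    refine ContDiffOn.sum fun i _ => ContDiffOn.mul (ContDiffOn.inv ?_ fun t ht =>
      (hlt t ht i).ne') contDiffOn_const
    fun_prop
  · obtain ⟨X, rfl⟩ := hsurj t ht X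
    have h1 : ⁅Z, X - t • g.raise h X⁆ = ⁅Z, X⁆ - t • g.raise h ⁅Z, X⁆ := by
      rw [hAlie Z hZ, lie_sub, lie_smul]
    have h2 : (LinearMap.id - t • g.raise h : 𝔤 →ₗ[ℝ] 𝔤) X = X - t • g.raise h X := rfl
    rw [h2, h1, hkey t ht, hkey t ht, hg Z hZ]
  · exact Metric.eq_of_form_eq fun X Y => by simpa using hkey 0 hmem0 X Y
  · have h1 : ∀ i, HasDerivAt (fun t => (1 - t * l i)⁻¹ * (e.repr X i * e.repr Y i))
        (l i * (e.repr X i * e.repr Y i)) 0 := fun i => by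
      have h2 : HasDerivAt (fun t => 1 - t * l i) (-(1 * l i)) 0 :=
        ((hasDerivAt_id (0 : ℝ)).mul_const (l i)).const_sub 1
      have h3 := (h2.fun_inv (by simp)).mul_const (e.repr X i * e.repr Y i)
      simpa using h3
    have h4 : h X Y = ∑ i, l i * (e.repr X i * e.repr Y i) := by
      conv_lhs => rw [← e.sum_repr X, map_sum, LinearMap.sum_apply]
      refine Finset.sum_congr rfl fun i _ => ?_
      rw [map_smul, LinearMap.smul_apply, hl, g.symm, ← repr_eq_of_orthonormal g.form e he,
        smul_eq_mul]
      ring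
    rw [h4]
    refine (HasDerivAt.fun_sum fun i _ => h1 i).congr_of_eventuallyEq ?_
    filter_upwards [Ioo_mem_nhds hmem0.1 hmem0.2] with t ht
    exact hform t ht X Y
  · have h1 : (γ t).raise T = g.raise T - t • (g.raise h ∘ₗ g.raise T) :=
      LinearMap.ext fun X => (γ t).ext_form fun Y => by
        rw [Metric.form_raise, LinearMap.sub_apply, LinearMap.smul_apply, LinearMap.comp_apply,
          hkey t ht, Metric.form_raise]
    rw [Metric.tr, h1, map_sub, map_smul, smul_eq_mul, Metric.tensorInner_comm]
    rfl

/-! ### Critical points and the equation `Ric = cT` -/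

variable [LieAlgebra.IsSimple ℝ 𝔤]

theorem isCriticalUpToScaling_of_ric_eq {g : Metric 𝔤} (hg : g ∈ natRed 𝔨)
    {T : LinearMap.BilinForm ℝ 𝔤} {c : ℝ} (hc : g.ric = c • T) :
    IsCriticalUpToScaling 𝔨 T g := by
  -- Scaling by `τ` divides the trace by `τ`, so `τ = |tr_g T|` normalizes a nonzero trace to `±1`.
  obtain ⟨τ, hτ, σ, hσ, htr⟩ :
      ∃ (τ : ℝ) (_ : 0 < τ), ∃ σ ∈ ({1, -1, 0} : Set ℝ), τ⁻¹ * g.tr T = σ := by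
    rcases lt_trichotomy (g.tr T) 0 with h | h | h
    · exact ⟨-g.tr T, neg_pos.2 h, -1, by simp, by rw [inv_neg, neg_mul, inv_mul_cancel₀ h.ne]⟩
    · exact ⟨1, one_pos, 0, by simp, by simp [h]⟩
    · exact ⟨g.tr T, h, 1, by simp, inv_mul_cancel₀ h.ne'⟩
  refine ⟨τ, hτ, σ, hσ, ⟨scale_mem_natRed hg τ hτ, by rw [g.tr_scale, htr]⟩, fun ε γ hγ => ?_⟩
  obtain ⟨h, hh⟩ := hγ.exists_hasVelocity
  have h1 := hasDerivAt_tr hh T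
  have h2 : HasDerivAt (fun t => (γ t).tr T) 0 0 := by
    refine (hasDerivAt_const (0 : ℝ) σ).congr_of_eventuallyEq ?_
    filter_upwards [Ioo_mem_nhds (neg_lt_zero.2 hγ.pos) hγ.pos] with t ht
    exact (hγ.mem t ht).2
  have h3 := hasDerivAt_scal hh trace_ad_eq_zero
  have h4 : (γ 0).ric = c • T := by rw [hγ.zero, g.ric_scale, hc]
  rwa [h4, Metric.tensorInner_smul_left, ← mul_neg, h1.unique h2, mul_zero] at h3

theorem exists_ric_eq_of_isCriticalUpToScaling (hC : IsCartanDecomposition 𝔨) {g : Metric 𝔤}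
    {T : LinearMap.BilinForm ℝ 𝔤} (hT : ∀ X Y, T X Y = T Y X) (hinv : IsInvariant 𝔨 T)
    (hcrit : IsCriticalUpToScaling 𝔨 T g) : ∃ c : ℝ, g.ric = c • T := by
  obtain ⟨τ, hτ, σ, -, ⟨⟨𝔪, h𝔪⟩, hσ⟩, hcrit⟩ := hcrit
  rw [← g.ric_scale τ hτ]
  set g' := g.scale τ hτ
  -- The coefficient of the orthogonal projection of Ric to the line of `T`. For `T = 0` the
  -- division gives `c = 0`, and orthogonality is trivial.
  set c := g'.tensorInner T g'.ric / g'.tensorInner T T with hcdef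
  have hricinv := g'.isInvariant_ric h𝔪.invariant
  have hhsymm : ∀ X Y, (g'.ric - c • T) X Y = (g'.ric - c • T) Y X := fun X Y => by
    simp [g'.ric_symm X Y, hT X Y]
  have hhinv : IsInvariant 𝔨 (g'.ric - c • T) := fun Z hZ X Y => by
    have h1 := hricinv Z hZ X Y
    have h2 := hinv Z hZ X Y
    simp only [LinearMap.sub_apply, LinearMap.smul_apply, smul_eq_mul]
    linear_combination h1 - c * h2
  have horth : g'.tensorInner T (g'.ric - c • T) = 0 := by
    rw [g'.tensorInner_comm, g'.tensorInner_sub_left, g'.tensorInner_smul_left,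
      g'.tensorInner_comm _ T]
    by_cases h0 : g'.tensorInner T T = 0
    · have hT0 : T = 0 := g'.eq_zero_of_tensorInner_self hT h0
      rw [h0, mul_zero, sub_zero, hT0]
      simp [Metric.tensorInner, Metric.raise]
    · rw [hcdef, div_mul_cancel₀ _ h0, sub_self]
  obtain ⟨ε, γ, hγ, hvel, htr⟩ := exists_curve g' h𝔪.invariant (g'.ric - c • T) hhsymm hhinv
  have hcurve : IsCurveIn (constraintSet 𝔨 T σ) g' ε γ :=
    ⟨hγ.pos, hγ.smooth, fun t ht => ⟨mem_natRed_of_isInvariant hC _ (hγ.mem t ht), by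
      rw [htr t ht, horth, mul_zero, sub_zero, hσ]⟩, hγ.zero⟩
  have h1 := (hasDerivAt_scal hvel trace_ad_eq_zero).unique (hcrit ε γ hcurve)
  rw [hγ.zero, neg_eq_zero] at h1
  refine ⟨c, sub_eq_zero.1 (g'.eq_zero_of_tensorInner_self hhsymm ?_)⟩
  rw [g'.tensorInner_sub_left, h1, g'.tensorInner_smul_left, horth, mul_zero, sub_zero]

end

end LeftInv

theorem mainTheorem5
    {E : Type*} [NormedAddCommGroup E] [NormedSpace ℝ E] [FiniteDimensional ℝ E]
    {G : Type*} [TopologicalSpace G] [ChartedSpace E G] [Group G] [LieGroup 𝓘(ℝ, E) ∞ G]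
    [T2Space G] [ConnectedSpace G] [NoncompactSpace G]
    [LieAlgebra.IsSimple ℝ (GroupLieAlgebra 𝓘(ℝ, E) G)]
    (K : Subgroup G) (hK : IsMaximalCompact K)
    (𝔨 : LieSubalgebra ℝ (GroupLieAlgebra 𝓘(ℝ, E) G))
    (hLie : (𝔨 : Set (GroupLieAlgebra 𝓘(ℝ, E) G)) = subgroupLieAlgebra K)
    (hCartan : IsCartanDecomposition 𝔨)
    (g : Metric (GroupLieAlgebra 𝓘(ℝ, E) G)) (hg : g ∈ natRed 𝔨) :
    (∀ ε γ h, IsCurveIn (natRed 𝔨) g ε γ → HasVelocity γ h →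
      HasDerivAt (fun t => (γ t).scal) (-g.tensorInner g.ric h) 0) ∧
    ∀ T : LinearMap.BilinForm ℝ (GroupLieAlgebra 𝓘(ℝ, E) G), (∀ X Y, T X Y = T Y X) →
      ((∃ c : ℝ, g.ric = c • T) → IsCriticalUpToScaling 𝔨 T g) ∧
      (IsInvariant 𝔨 T → ((∃ c : ℝ, g.ric = c • T) ↔ IsCriticalUpToScaling 𝔨 T g)) := by
  refine ⟨fun ε γ h hγ hvel => ?_, fun T hT => ⟨?_, fun hinv => ⟨?_, ?_⟩⟩⟩
  · rw [← hγ.zero]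
    exact hasDerivAt_scal hvel trace_ad_eq_zero
  · rintro ⟨c, hc⟩
    exact isCriticalUpToScaling_of_ric_eq hg hc
  · rintro ⟨c, hc⟩
    exact isCriticalUpToScaling_of_ric_eq hg hc
  · exact exists_ric_eq_of_isCriticalUpToScaling hCartan hT hinv
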